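/- Let $(\Omega,\mathcal F,(\mathcal F_s)_{s\ge 0},P)$ be a filtered probability space carrying a standard Brownian motion $B$ relative to $(\mathcal F_s)$, and let $\gamma,\rho,\sigma\in\mathbb R$, $\varepsilon>0$ and $T\ge 0$. For $t\in[0,T]$ and $r>0$, an admissible pair $(\mu,R)$ consists of a measurable, $(\mathcal F_s)$-adapted control $\mu=(\mu_s)_{t\le s\le T}$ with $P\big(\sup_{t\le s\le T}|\mu_s|\le\varepsilon\big)=1$ and a continuous adapted positive process $R=(R_s)_{t\le s\le T}$ solving $$dR_s=R_s\,(\mu_s\,ds+\sigma\,dB_s),\qquad R_t=r ,$$ in the Itô sense. Let $$v(r,t)=\sup_{(\mu,R)}\ \mathbb E\Big[\int_t^T e^{-\rho s}(1-\mu_s)R_s^{\gamma}\,ds\Big]$$ be the value function of the growth rate $(1-\mu)R^\gamma$, the supremum being over all admissible pairs. Then: 1. The terminal value problem $$1-\rho\psi(t)+\psi'(t)+\tfrac{\sigma^2}{2}\gamma(\gamma-1)\psi(t)+\varepsilon\,|\gamma\psi(t)-1|=0\quad(0\le t\le T),\qquad \psi(T)=0,$$ has a solution $\psi$ on $[0,T]$,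 and for every solution $\psi$, $$v(r,t)=e^{-\rho t}\,\psi(t)\,r^{\gamma}\qquad\text{for all } t\in[0,T],\ r>0$$ (so $\psi$ is unique). For every admissible pair the integral inside the expectation has finite expectation. The value is the same if the supremum is restricted to the admissible pairs whose control is adapted to the filtration generated by $R$. 2. The bang-bang control $\mu_s=\varepsilon\,\operatorname{sgn}(\gamma\psi(s)-1)$, where $\operatorname{sgn}(0)=0$, is optimal: there is a reputation process $R$ forming an admissible pair with it, and every such pair attains the supremum $v(r,t)$. 3. If $\gamma=1$ and $\rho=0$, then for $t\in[0,T]$ $$\psi(t)=\begin{cases}\dfrac{1+\varepsilon}{\varepsilon}\big(1-e^{-\varepsilon(T-t)}\big), & T-\frac1\varepsilon\ln(1+\varepsilon)\le t\le T,\\[2mm] \dfrac{e^{\varepsilon(T-t)}-(1-\varepsilon^2)}{\varepsilon(1+\varepsilon)}, & 0\le t\le T-\frac1\varepsilon\ln(1+\varepsilon),\end{cases}$$ and the optimal control of part 2 equals $\varepsilon$ for $0\le t<T-\frac1\varepsilon\ln(1+\varepsilon)$ and $-\varepsilon$ for $T-\frac1\varepsilon\ln(1+\varepsilon)<t\le T$;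 thus it has at most one switch, at $T-\frac1\varepsilon\ln(1+\varepsilon)$. -/

import Mathlib

open MeasureTheory ProbabilityTheory Filter
open scoped NNReal

namespace Reputation

variable {Ω : Type*} {mΩ : MeasurableSpace Ω}

/-- `B` is a standard (continuous) Brownian motion relative to the filtration `𝓕`. -/
structure IsBrownianMotion (P : Measure Ω) (𝓕 : Filtration ℝ≥0 mΩ) (B : ℝ≥0 → Ω → ℝ) : Prop where
  isBrownianReal : IsBrownianReal B P
  adapted : ∀ s, Measurable[𝓕 s] (B s)
  indep_increments : ∀ s u, s ≤ u →
    Indep (MeasurableSpace.comap (fun ω => B u ω - B s ω) inferInstance) (𝓕 s) P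

/-- The left-endpoint sum `∑_{i < n} H_{τ i} (B_{τ (i+1)} - B_{τ i})`. -/
noncomputable def leftSum (B : ℝ≥0 → Ω → ℝ) (H : ℝ → Ω → ℝ) (n : ℕ) (τ : ℕ → ℝ) (ω : Ω) : ℝ :=
  ∑ i ∈ Finset.range n,
    H (τ i) ω * (B (τ (i + 1)).toNNReal ω - B (τ i).toNNReal ω)

/-- `I` is the Itô integral `∫_a^b H dB` of a process `H` that is adapted and has almost surely
continuous paths on `[a, b]`: along every sequence of partitions
`a = τ k 0 ≤ τ k 1 ≤ ⋯ ≤ τ k (n k) = b` with mesh tending to zero, the left-endpoint sums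
converge to `I` in probability. (Adaptedness and continuity are required where this is used.) -/
def IsItoIntegral (P : Measure Ω) (B : ℝ≥0 → Ω → ℝ) (H : ℝ → Ω → ℝ) (a b : ℝ) (I : Ω → ℝ) : Prop :=
  ∀ (n : ℕ → ℕ) (τ : ℕ → ℕ → ℝ),
    (∀ k, Monotone (τ k)) → (∀ k, τ k 0 = a) → (∀ k, τ k (n k) = b) →
    (∀ δ : ℝ, 0 < δ → ∀ᶠ k in atTop, ∀ i < n k, τ k (i + 1) - τ k i < δ) →
    TendstoInMeasure P (fun k => leftSum B H (n k) (τ k)) atTop I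

/-- `R` is a (strong) solution on `[t, T]`, with values in `(0, ∞)`, of the stochastic
differential equation `dR = R (μ ds + σ dB)` with `R_t = r`. -/
structure IsReputation (P : Measure Ω) (𝓕 : Filtration ℝ≥0 mΩ) (B : ℝ≥0 → Ω → ℝ)
    (σ T t r : ℝ) (μ R : ℝ → Ω → ℝ) : Prop where
  adapted : ∀ s ∈ Set.Icc t T, Measurable[𝓕 s.toNNReal] (R s)
  continuousOn : ∀ᵐ ω ∂P, ContinuousOn (fun s => R s ω) (Set.Icc t T)
  pos : ∀ᵐ ω ∂P, ∀ s ∈ Set.Icc t T, 0 < R s ω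
  initial : ∀ᵐ ω ∂P, R t ω = r
  sde : ∃ I : ℝ → Ω → ℝ, ∀ s ∈ Set.Icc t T,
    IsItoIntegral P B R t s (I s) ∧
    ∀ᵐ ω ∂P, R s ω = r + (∫ u in t..s, R u ω * μ u ω) + σ * I s ω

/-- `μ` is a control on `[t, T]`: a measurable process, adapted to `𝓕`, with
`P (sup_{t ≤ s ≤ T} |μ_s| ≤ ε) = 1`. -/
structure IsControl (P : Measure Ω) (𝓕 : Filtration ℝ≥0 mΩ) (ε T t : ℝ) (μ : ℝ → Ω → ℝ) :
    Prop where
  measurable : Measurable (fun p : Set.Icc t T × Ω => μ p.1 p.2)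
  adapted : ∀ s ∈ Set.Icc t T, Measurable[𝓕 s.toNNReal] (μ s)
  bound : ∀ᵐ ω ∂P, ∀ s ∈ Set.Icc t T, |μ s ω| ≤ ε

/-- The pair of an `𝓕`-adapted control `μ` and a reputation `R` controlled by it,
started from `r` at time `t`. -/
structure IsAdmissible (P : Measure Ω) (𝓕 : Filtration ℝ≥0 mΩ) (B : ℝ≥0 → Ω → ℝ)
    (σ ε T t r : ℝ) (μ R : ℝ → Ω → ℝ) : Prop where
  control : IsControl P 𝓕 ε T t μ
  state : IsReputation P 𝓕 B σ T t r μ R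

/-- The σ-algebra generated by `R_u`, `t ≤ u ≤ s`. -/
abbrev history (R : ℝ → Ω → ℝ) (t s : ℝ) : MeasurableSpace Ω :=
  ⨆ u ∈ Set.Icc t s, MeasurableSpace.comap (R u) inferInstance

/-- Admissible pairs whose control is moreover adapted to the filtration generated by `R`. -/
structure IsHistoryAdmissible (P : Measure Ω) (𝓕 : Filtration ℝ≥0 mΩ) (B : ℝ≥0 → Ω → ℝ)
    (σ ε T t r : ℝ) (μ R : ℝ → Ω → ℝ) : Prop where
  admissible : IsAdmissible P 𝓕 B σ ε T t r μ R
  adapted_history : ∀ s ∈ Set.Icc t T, Measurable[history R t s] (μ s)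

/-- The discounted gain `∫_t^T e^{-ρ s} (1 - μ_s) R_s^γ ds` along a path. -/
noncomputable def gain (γ ρ T t : ℝ) (μ R : ℝ → Ω → ℝ) (ω : Ω) : ℝ :=
  ∫ s in t..T, Real.exp (-ρ * s) * (1 - μ s ω) * R s ω ^ γ

/-- The expected gains of the control-reputation pairs in the class `𝒜`. -/
def expectedGains (P : Measure Ω) (γ ρ T t : ℝ) (𝒜 : (ℝ → Ω → ℝ) → (ℝ → Ω → ℝ) → Prop) : Set ℝ :=
  {J | ∃ μ R, 𝒜 μ R ∧ J = ∫ ω, gain γ ρ T t μ R ω ∂P}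

/-- The value: the supremum of the expected gains over the class `𝒜`. -/
noncomputable def value (P : Measure Ω) (γ ρ T t : ℝ)
    (𝒜 : (ℝ → Ω → ℝ) → (ℝ → Ω → ℝ) → Prop) : ℝ :=
  sSup (expectedGains P γ ρ T t 𝒜)

/-- `ψ` solves, on `[0, T]`,
`1 - ρ ψ + ψ' + (σ² / 2) γ (γ - 1) ψ + ε |γ ψ - 1| = 0` with `ψ(T) = 0`. -/
structure SolvesODE (γ ρ σ ε T : ℝ) (ψ : ℝ → ℝ) : Prop where
  ode : ∀ t ∈ Set.Icc 0 T, ∃ d, HasDerivWithinAt ψ d (Set.Icc 0 T) t ∧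
    1 - ρ * ψ t + d + σ ^ 2 / 2 * γ * (γ - 1) * ψ t + ε * |γ * ψ t - 1| = 0
  terminal : ψ T = 0

/-- The bang-bang control `ε sgn (γ ψ(s) - 1)`. -/
noncomputable def bangBang (γ ε : ℝ) (ψ : ℝ → ℝ) (s : ℝ) : ℝ :=
  ε * Real.sign (γ * ψ s - 1)

end Reputation

/-! The proof rests on an explicit formula for the state. Under a control μ the only reputation is
R_s = r exp(∫_t^s μ) M_s, where M_s = exp(σ(B_s - B_t) - σ²(s - t)/2). Raising this to the power γ
gives r^γ exp(γ∫_t^s μ) exp(σ²γ(γ-1)(s - t)/2) N_s, where N is the exponential martingale with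
exponent γσ. The remaining factor of the running gain is bounded and almost surely equal to an
𝓕_s-measurable variable, so N_s may be replaced by N_T under the expectation. By Fubini, the
expected gain is then a constant times E[N_T ∫_t^T `reward` ds] (`IsAdmissible.integral_gain`).

This reduces the stochastic control problem to a deterministic one on each path, and no Itô formula
for e^{-ρs}ψ(s)R_s^γ is needed. Put κ = σ²γ(γ-1)/2 - ρ and differentiate e^{κs} ψ(s) exp(γ∫_t^s m).
The equation for ψ turns minus this derivative into the reward plus a positive multiple of ε|γψ - 1|
- (γψ - 1)m. That term is nonnegative when |m| ≤ ε and vanishes for the bang-bang control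
(`SolvesODE.integral_eq`). Multiplying by N_T and using E N_T = 1 gives the upper bound and its
attainment. The bang-bang control is deterministic, hence adapted to every filtration, so
restricting the information to the history of R loses nothing.

Most of the work is the uniqueness half of the formula for R, because the Itô integral is given only
at fixed times, as a limit in probability of left-endpoint sums. Itô's formula for log R is proved
directly: log(R_b/R_a) = ∑ log(1 + p_i) with p_i the relative increments, and ∑ log(1 + p_i) tends
to lim ∑ p_i - (1/2) lim ∑ p_i² (`log_sub_log_eq_of_tendsto`). The stochastic errors are controlled
in L² by orthogonality of Brownian increments. The integral is replaced by left sums along much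
finer grids (`exists_refinement`), and R is truncated to an interval [c, K] instead of being stopped
(`IsBrownianMotion.ae_log_eq_of_mem_Icc`). Existence, for deterministic controls, is a summation by
parts against M (`isItoIntegral_of_primitive`, `IsBrownianMotion.exists_seq_sum_expMart`).

The equation for ψ has a globally Lipschitz right-hand side, which yields existence and, by
comparison with explicit candidates, the formulas for γ = 1, ρ = 0. -/

namespace Reputation

variable {Ω : Type*} {mΩ : MeasurableSpace Ω}

/-! ### The terminal value problem for ψ. -/

open Set in
/-- A globally Lipschitz autonomous equation has a solution on every interval `[0, T]`. -/
theorem exists_solution_of_lipschitzWith {f : ℝ → ℝ} {K : ℝ≥0} (hf : LipschitzWith K f)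
    {T : ℝ} (hT : 0 ≤ T) (x₀ : ℝ) :
    ∃ y : ℝ → ℝ, y 0 = x₀ ∧ ∀ t ∈ Icc 0 T, HasDerivWithinAt y (f (y t)) (Icc 0 T) t := by
  -- M is Grönwall's a priori bound under |f x| ≤ K|x| + |f 0|. Truncating the argument of f to [-M,
  -- M] makes the field bounded, so Picard-Lindelöf works on all of [0, T] at once.
  set M : ℝ := gronwallBound |x₀| K |f 0| T with hM
  have hmono := gronwallBound_mono (abs_nonneg x₀) (abs_nonneg (f 0)) K.coe_nonneg
  have hxM : |x₀| ≤ M := by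
    have := hmono hT
    rwa [gronwallBound_x0] at this
  have hM0 : 0 ≤ M := (abs_nonneg _).trans hxM
  set c : ℝ → ℝ := fun x => max (-M) (min M x) with hc
  have hcl : LipschitzWith 1 c := (LipschitzWith.id.const_min M).const_max (-M)
  have hcM : ∀ x, |c x| ≤ M := fun x =>
    abs_le.2 ⟨le_max_left _ _, max_le (by linarith) (min_le_left _ _)⟩
  have hcid : ∀ x, |x| ≤ M → c x = x := fun x hx => by
    rw [abs_le] at hx
    simp only [hc, min_eq_right hx.2, max_eq_right hx.1]
  have hcle : ∀ x, |c x| ≤ |x| := fun x => by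
    rcases le_total (|x|) M with h | h
    · rw [hcid x h]
    · exact (hcM x).trans h
  have hflin : ∀ x, |f x| ≤ K * |x| + |f 0| := fun x => by
    have h := hf.dist_le_mul x 0
    rw [Real.dist_eq, Real.dist_eq, sub_zero] at h
    have := abs_sub_abs_le_abs_sub (f x) (f 0)
    linarith
  have hg : LipschitzWith K (f ∘ c) := by simpa using hf.comp hcl
  set L : ℝ≥0 := ⟨K * M + |f 0|, by positivity⟩ with hL
  have hb : ∀ x, ‖(f ∘ c) x‖ ≤ L := fun x =>
    (hflin (c x)).trans (by
      change _ ≤ K * M + |f 0|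
      gcongr
      exact hcM x)
  have hPL : IsPicardLindelof (fun _ : ℝ => f ∘ c) (⟨0, ⟨le_rfl, hT⟩⟩ : Icc (0 : ℝ) T) x₀
      (L * ⟨T, hT⟩) 0 L K :=
    IsPicardLindelof.of_time_independent (fun x _ => hb x) hg.lipschitzOnWith (by simp [hT]; exact le_rfl)
  obtain ⟨y, hy0, hy⟩ := hPL.exists_eq_forall_mem_Icc_hasDerivWithinAt₀
  have hyc : ContinuousOn y (Icc 0 T) := fun t ht => (hy t ht).continuousWithinAt
  -- Truncation does not increase absolute values, so the truncated field obeys the same linear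
  -- growth bound. Hence |y| ≤ M, and the truncation never acts along y.
  have hbound : ∀ t ∈ Icc 0 T, ‖y t‖ ≤ gronwallBound |x₀| K |f 0| (t - 0) := by
    refine norm_le_gronwallBound_of_norm_deriv_right_le (f' := fun t => (f ∘ c) (y t)) hyc
      (fun t ht => ?_) (by rw [← hy0]; rfl) (fun t _ => ?_)
    · exact (hy t (Ico_subset_Icc_self ht)).mono_of_mem_nhdsWithin
        (mem_of_superset (Icc_mem_nhdsGE ht.2) (Icc_subset_Icc_left ht.1))
    · refine (hflin _).trans ?_
      gcongr
      exact hcle _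
  refine ⟨y, hy0, fun t ht => ?_⟩
  have h := hy t ht
  have hty : |y t| ≤ M := (hbound t ht).trans (hmono (by linarith [ht.2]))
  simp only [Function.comp_apply, hcid _ hty] at h
  exact h

/-- The right-hand side `y' = F y` of the equation for `ψ`, so that `ψ' = -F ψ`. -/
noncomputable def odeField (γ ρ σ ε : ℝ) (x : ℝ) : ℝ :=
  1 - ρ * x + σ ^ 2 / 2 * γ * (γ - 1) * x + ε * |γ * x - 1|

theorem lipschitzWith_odeField (γ ρ σ ε : ℝ) :
    ∃ K : ℝ≥0, LipschitzWith K (odeField γ ρ σ ε) := by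
  refine ⟨⟨|ρ| + |σ ^ 2 / 2 * γ * (γ - 1)| + |ε| * |γ|, by positivity⟩,
    LipschitzWith.of_dist_le_mul fun x y => ?_⟩
  change |odeField γ ρ σ ε x - odeField γ ρ σ ε y|
    ≤ (|ρ| + |σ ^ 2 / 2 * γ * (γ - 1)| + |ε| * |γ|) * |x - y|
  have h1 : odeField γ ρ σ ε x - odeField γ ρ σ ε y = -ρ * (x - y)
      + σ ^ 2 / 2 * γ * (γ - 1) * (x - y) + ε * (|γ * x - 1| - |γ * y - 1|) := by
    simp only [odeField]; ring
  have h2 : |(|γ * x - 1| - |γ * y - 1|)| ≤ |γ| * |x - y| := by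
    refine (abs_abs_sub_abs_le_abs_sub _ _).trans_eq ?_
    rw [← abs_mul]; ring_nf
  rw [h1]
  refine (abs_add_le _ _).trans ?_
  refine (add_le_add_left (abs_add_le _ _) _).trans ?_
  rw [abs_mul, abs_mul (σ ^ 2 / 2 * γ * (γ - 1)), abs_mul ε, abs_neg]
  have := mul_le_mul_of_nonneg_left h2 (abs_nonneg ε)
  linarith

/-- Time reversal: ψ(t) = y(T - t), where y solves y' = F y with y(0) = 0. -/
theorem exists_solvesODE (γ ρ σ ε : ℝ) {T : ℝ} (hT : 0 ≤ T) :
    ∃ ψ : ℝ → ℝ, SolvesODE γ ρ σ ε T ψ := by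
  obtain ⟨K, hK⟩ := lipschitzWith_odeField γ ρ σ ε
  obtain ⟨y, hy0, hy⟩ := exists_solution_of_lipschitzWith hK hT 0
  refine ⟨fun t => y (T - t), ⟨fun t ht => ?_, by simpa using hy0⟩⟩
  have hmaps : Set.MapsTo (fun s => T - s) (Set.Icc 0 T) (Set.Icc 0 T) :=
    fun s hs => ⟨by linarith [hs.2], by linarith [hs.1]⟩
  have h := (hy (T - t) (hmaps ht)).scomp t
    (((hasDerivAt_id t).const_sub T).hasDerivWithinAt (s := Set.Icc 0 T)) hmaps
  refine ⟨_, h, ?_⟩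
  simp only [odeField, smul_eq_mul]
  ring

/-- Two solutions of the terminal value problem on `[a, b]` that agree at `b` coincide. -/
theorem eqOn_of_hasDerivWithinAt_odeField {γ ρ σ ε a b : ℝ} {f g : ℝ → ℝ}
    (hf : ∀ t ∈ Set.Icc a b, HasDerivWithinAt f (-odeField γ ρ σ ε (f t)) (Set.Icc a b) t)
    (hg : ∀ t ∈ Set.Icc a b, HasDerivWithinAt g (-odeField γ ρ σ ε (g t)) (Set.Icc a b) t)
    (hb : f b = g b) : Set.EqOn f g (Set.Icc a b) := by
  obtain ⟨K, hK⟩ := lipschitzWith_odeField γ ρ σ ε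
  have hleft : ∀ {h : ℝ → ℝ} {d t : ℝ}, t ∈ Set.Ioc a b → HasDerivWithinAt h d (Set.Icc a b) t →
      HasDerivWithinAt h d (Set.Iic t) t := fun ht h =>
    h.mono_of_mem_nhdsWithin
      (mem_of_superset (Icc_mem_nhdsLE ht.1) (Set.Icc_subset_Icc_right ht.2))
  exact ODE_solution_unique_of_mem_Icc_left (v := fun _ x => -odeField γ ρ σ ε x)
    (s := fun _ => Set.univ) (K := K)
    (fun t _ => hK.neg.lipschitzOnWith)
    (fun t ht => (hf t ht).continuousWithinAt)
    (fun t ht => hleft ht (hf t (Set.Ioc_subset_Icc_self ht))) (fun _ _ => trivial)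
    (fun t ht => (hg t ht).continuousWithinAt)
    (fun t ht => hleft ht (hg t (Set.Ioc_subset_Icc_self ht))) (fun _ _ => trivial) hb

theorem SolvesODE.hasDerivWithinAt {γ ρ σ ε T : ℝ} {ψ : ℝ → ℝ} (h : SolvesODE γ ρ σ ε T ψ)
    {t : ℝ} (ht : t ∈ Set.Icc 0 T) :
    HasDerivWithinAt ψ (-odeField γ ρ σ ε (ψ t)) (Set.Icc 0 T) t := by
  obtain ⟨d, hd, hode⟩ := h.ode t ht
  convert hd using 1
  simp only [odeField]
  linarith

theorem SolvesODE.continuousOn {γ ρ σ ε T : ℝ} {ψ : ℝ → ℝ} (h : SolvesODE γ ρ σ ε T ψ) :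
    ContinuousOn ψ (Set.Icc 0 T) :=
  fun _ ht => (h.hasDerivWithinAt ht).continuousWithinAt

/-! ### The explicit solution and the switching time for γ = 1, ρ = 0. -/

section Explicit

variable {σ ε T : ℝ} {ψ : ℝ → ℝ}

theorem hasDerivAt_lateSolution (hε : 0 < ε) (t : ℝ) :
    HasDerivAt (fun t => (1 + ε) / ε * (1 - Real.exp (-ε * (T - t))))
      (-(1 + ε) * Real.exp (-ε * (T - t))) t := by
  have h : HasDerivAt (fun t => -ε * (T - t)) ε t := by
    simpa using ((hasDerivAt_id t).const_sub T).const_mul (-ε)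
  refine ((h.exp.const_sub 1).const_mul ((1 + ε) / ε)).congr_deriv ?_
  field_simp

theorem hasDerivAt_earlySolution (hε : 0 < ε) (t : ℝ) :
    HasDerivAt (fun t => (Real.exp (ε * (T - t)) - (1 - ε ^ 2)) / (ε * (1 + ε)))
      (-(Real.exp (ε * (T - t)) / (1 + ε))) t := by
  have h : HasDerivAt (fun t => ε * (T - t)) (-ε) t := by
    simpa using ((hasDerivAt_id t).const_sub T).const_mul ε
  refine ((h.exp.sub_const (1 - ε ^ 2)).div_const (ε * (1 + ε))).congr_deriv ?_
  field_simp

/-- After the switching time the candidate stays at most 1, since there exp(-ε(T - s)) ≥ 1/(1 + ε).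
So |ψ - 1| opens as 1 - ψ, the candidate solves the resulting linear equation, and uniqueness
backwards from T identifies it with ψ. -/
theorem SolvesODE.eq_lateSolution (hε : 0 < ε) (h : SolvesODE 1 0 σ ε T ψ) {t : ℝ}
    (ht : t ∈ Set.Icc 0 T) (hs : T - Real.log (1 + ε) / ε ≤ t) :
    ψ t = (1 + ε) / ε * (1 - Real.exp (-ε * (T - t))) := by
  refine eqOn_of_hasDerivWithinAt_odeField (γ := 1) (ρ := 0) (σ := σ) (ε := ε) (a := t) (b := T)
    (g := fun t => (1 + ε) / ε * (1 - Real.exp (-ε * (T - t)))) (fun s hs' =>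
      (h.hasDerivWithinAt ⟨ht.1.trans hs'.1, hs'.2⟩).mono (Set.Icc_subset_Icc_left ht.1))
    (fun s hs' => ((hasDerivAt_lateSolution hε s).congr_deriv ?_).hasDerivWithinAt)
    (by simpa using h.terminal) ⟨le_rfl, ht.2⟩
  have h1 : 1 / (1 + ε) ≤ Real.exp (-ε * (T - s)) := by
    rw [one_div, ← Real.exp_log (by positivity : 0 < (1 + ε)), ← Real.exp_neg]
    gcongr
    have := (sub_le_comm.1 (hs.trans hs'.1))
    rw [le_div_iff₀ hε] at this
    linarith
  have h2 : (1 + ε) / ε * (1 - Real.exp (-ε * (T - s))) ≤ 1 := by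
    rw [div_le_iff₀ (by positivity)] at h1
    rw [div_mul_eq_mul_div, div_le_one hε]
    linarith
  simp only [odeField]
  rw [abs_of_nonpos (by linarith)]
  field_simp
  ring

/-- Before the switching time the candidate is at least 1, so the absolute value opens the other
way. The comparison starts at the switching time, where both formulas give 1. -/
theorem SolvesODE.eq_earlySolution (hε : 0 < ε) (h : SolvesODE 1 0 σ ε T ψ) {t : ℝ}
    (ht : t ∈ Set.Icc 0 T) (hs : t ≤ T - Real.log (1 + ε) / ε) :
    ψ t = (Real.exp (ε * (T - t)) - (1 - ε ^ 2)) / (ε * (1 + ε)) := by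
  have hlog : 0 ≤ Real.log (1 + ε) / ε := div_nonneg (Real.log_nonneg (by linarith)) hε.le
  have hle : T - Real.log (1 + ε) / ε ≤ T := by linarith
  refine eqOn_of_hasDerivWithinAt_odeField (γ := 1) (ρ := 0) (σ := σ) (ε := ε) (a := t)
    (b := T - Real.log (1 + ε) / ε)
    (g := fun t => (Real.exp (ε * (T - t)) - (1 - ε ^ 2)) / (ε * (1 + ε))) (fun s hs' =>
      (h.hasDerivWithinAt ⟨ht.1.trans hs'.1, hs'.2.trans hle⟩).mono
        (Set.Icc_subset_Icc ht.1 hle))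
    (fun s hs' => ((hasDerivAt_earlySolution hε s).congr_deriv ?_).hasDerivWithinAt)
    ?_ ⟨le_rfl, hs⟩
  · have h1 : 1 + ε ≤ Real.exp (ε * (T - s)) := by
      rw [← Real.log_le_iff_le_exp (by positivity)]
      have := (le_sub_comm.1 hs'.2)
      rw [div_le_iff₀ hε] at this
      linarith
    have h2 : 1 ≤ (Real.exp (ε * (T - s)) - (1 - ε ^ 2)) / (ε * (1 + ε)) := by
      rw [le_div_iff₀ (by positivity)]
      linarith
    simp only [odeField]
    rw [abs_of_nonneg (by linarith)]
    field_simp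
    ring
  · rw [h.eq_lateSolution hε ⟨ht.1.trans hs, hle⟩ le_rfl]
    have h3 : ε * (T - (T - Real.log (1 + ε) / ε)) = Real.log (1 + ε) := by field_simp; ring
    rw [neg_mul, Real.exp_neg, h3, Real.exp_log (by positivity)]
    field_simp
    ring

theorem SolvesODE.bangBang_early (hε : 0 < ε) (h : SolvesODE 1 0 σ ε T ψ) {t : ℝ}
    (ht : t ∈ Set.Icc 0 T) (hs : t < T - Real.log (1 + ε) / ε) : bangBang 1 ε ψ t = ε := by
  have h1 : 1 + ε < Real.exp (ε * (T - t)) := by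
    rw [← Real.log_lt_iff_lt_exp (by positivity)]
    have := (lt_sub_comm.1 hs)
    rw [div_lt_iff₀ hε] at this
    linarith
  have h2 : 1 < ψ t := by
    rw [h.eq_earlySolution hε ht hs.le, lt_div_iff₀ (by positivity)]
    linarith
  rw [bangBang, Real.sign_of_pos (by linarith), mul_one]

theorem SolvesODE.bangBang_late (hε : 0 < ε) (h : SolvesODE 1 0 σ ε T ψ) {t : ℝ}
    (ht : t ∈ Set.Icc 0 T) (hs : T - Real.log (1 + ε) / ε < t) : bangBang 1 ε ψ t = -ε := by
  have h1 : 1 / (1 + ε) < Real.exp (-ε * (T - t)) := by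
    rw [one_div, ← Real.exp_log (by positivity : 0 < (1 + ε)), ← Real.exp_neg]
    gcongr
    have := (sub_lt_comm.1 hs)
    rw [lt_div_iff₀ hε] at this
    linarith
  have h2 : ψ t < 1 := by
    rw [h.eq_lateSolution hε ht hs.le, div_mul_eq_mul_div, div_lt_one hε]
    rw [div_lt_iff₀ (by positivity)] at h1
    linarith
  rw [bangBang, Real.sign_of_neg (by linarith), mul_neg, mul_one]

end Explicit

/-! ### Fundamental theorem of calculus with a merely measurable rate. -/

section Calculus

theorem lipschitzWith_integral {m : ℝ → ℝ} {C : ℝ} (hm : Measurable m) (hC : ∀ s, |m s| ≤ C)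
    (a : ℝ) : LipschitzWith C.toNNReal (fun s => ∫ u in a..s, m u) := by
  have hint : ∀ x y, IntervalIntegrable m volume x y := fun x y =>
    (intervalIntegrable_const (c := C)).mono_fun hm.aestronglyMeasurable
      (Eventually.of_forall fun s => (hC s).trans (le_abs_self C))
  refine LipschitzWith.of_dist_le_mul fun x y => ?_
  rw [Real.dist_eq, intervalIntegral.integral_interval_sub_left (hint _ _) (hint _ _),
    Real.dist_eq, Real.coe_toNNReal _ ((abs_nonneg _).trans (hC 0))]
  exact intervalIntegral.norm_integral_le_of_norm_le_const (f := m) fun s _ => hC s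

theorem intervalIntegrable_of_bound {m : ℝ → ℝ} {C : ℝ} (hm : Measurable m)
    (hC : ∀ s, |m s| ≤ C) (x y : ℝ) : IntervalIntegrable m volume x y :=
  (intervalIntegrable_const (c := C)).mono_fun hm.aestronglyMeasurable
      (Eventually.of_forall fun s => (hC s).trans (le_abs_self C))

/-- Fundamental theorem of calculus for `g(s) exp (∫_a^s m)` with `m` bounded and measurable. -/
theorem integral_deriv_add_mul_mul_exp_integral {g g' m : ℝ → ℝ} {a b C : ℝ} (hab : a ≤ b)
    (hg : ∀ s ∈ Set.Icc a b, HasDerivWithinAt g (g' s) (Set.Icc a b) s)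
    (hg' : ContinuousOn g' (Set.Icc a b)) (hm : Measurable m) (hC : ∀ s, |m s| ≤ C) :
    ∫ s in a..b, (g' s + g s * m s) * Real.exp (∫ u in a..s, m u)
      = g b * Real.exp (∫ u in a..b, m u) - g a := by
  obtain ⟨D, hD⟩ := isCompact_Icc.exists_bound_of_continuousOn hg'
  -- The primitive of m is differentiable only almost everywhere. Both factors are Lipschitz on [a,
  -- b], hence absolutely continuous, and this suffices for integrating the product rule.
  have hgL : LipschitzOnWith D.toNNReal g (Set.Icc a b) := by
    refine (convex_Icc a b).lipschitzOnWith_of_nnnorm_hasDerivWithin_le hg fun s hs => ?_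
    rw [← norm_toNNReal]
    exact Real.toNNReal_le_toNNReal (hD s hs)
  have hM := lipschitzWith_integral hm hC a
  obtain ⟨S, hS⟩ := isCompact_Icc.exists_bound_of_continuousOn
    (hM.continuous.continuousOn (s := Set.Icc a b))
  obtain ⟨K, hK⟩ := (Real.contDiff_exp (n := 1)).contDiffOn.exists_lipschitzOnWith
    (by decide) (convex_Icc (-S) S) isCompact_Icc
  have hEL : LipschitzOnWith (K * C.toNNReal) (fun s => Real.exp (∫ u in a..s, m u))
      (Set.Icc a b) :=
    hK.comp hM.lipschitzOnWith fun s hs => abs_le.1 (hS s hs)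
  rw [← Set.uIcc_of_le hab] at hgL hEL
  have h := hgL.absolutelyContinuousOnInterval.integral_deriv_mul_eq_sub
    hEL.absolutelyContinuousOnInterval
  simp only [intervalIntegral.integral_same, Real.exp_zero, mul_one] at h
  rw [← h]
  refine intervalIntegral.integral_congr_ae ?_
  have hb : ∀ᵐ s : ℝ, s ≠ b := Measure.ae_ne _ _
  filter_upwards [(intervalIntegrable_of_bound hm hC a b).ae_hasDerivAt_integral, hb]
    with s hs hsb hsI
  rw [Set.uIoc_of_le hab] at hsI
  have hs1 : HasDerivAt g (g' s) s :=
    (hg s ⟨hsI.1.le, hsI.2⟩).hasDerivAt (Icc_mem_nhds hsI.1 (lt_of_le_of_ne hsI.2 hsb))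
  have hs2 := (hs (by rw [Set.uIcc_of_le hab]; exact ⟨hsI.1.le, hsI.2⟩) a
    Set.left_mem_uIcc).exp
  rw [hs1.deriv, hs2.deriv]
  ring

end Calculus

/-! ### Partitions with vanishing mesh and Riemann-Stieltjes sums. -/

section Partition

/-- `τ k 0 = a ≤ τ k 1 ≤ ⋯ ≤ τ k (n k) = b` are partitions of `[a, b]` with mesh tending to zero. -/
structure IsPartitionSeq (a b : ℝ) (n : ℕ → ℕ) (τ : ℕ → ℕ → ℝ) : Prop where
  mono : ∀ k, Monotone (τ k)
  left : ∀ k, τ k 0 = a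
  right : ∀ k, τ k (n k) = b
  mesh : ∀ δ : ℝ, 0 < δ → ∀ᶠ k in atTop, ∀ i < n k, τ k (i + 1) - τ k i < δ

variable {a b : ℝ} {n : ℕ → ℕ} {τ : ℕ → ℕ → ℝ}

theorem IsPartitionSeq.mem_Icc (h : IsPartitionSeq a b n τ) {k i : ℕ} (hi : i ≤ n k) :
    τ k i ∈ Set.Icc a b :=
  ⟨(h.left k).symm.trans_le (h.mono k (Nat.zero_le i)), (h.mono k hi).trans_eq (h.right k)⟩

theorem IsPartitionSeq.le (h : IsPartitionSeq a b n τ) : a ≤ b :=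
  (h.mem_Icc (k := 0) (i := 0) (Nat.zero_le _)).1.trans
    (h.mem_Icc (k := 0) (i := 0) (Nat.zero_le _)).2

theorem IsPartitionSeq.comp (h : IsPartitionSeq a b n τ) {ns : ℕ → ℕ} (hns : StrictMono ns) :
    IsPartitionSeq a b (n ∘ ns) (τ ∘ ns) :=
  ⟨fun _ => h.mono _, fun _ => h.left _, fun _ => h.right _,
    fun δ hδ => hns.tendsto_atTop.eventually (h.mesh δ hδ)⟩

theorem IsPartitionSeq.sum_sub (h : IsPartitionSeq a b n τ) (f : ℝ → ℝ) (k : ℕ) :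
    ∑ i ∈ Finset.range (n k), (f (τ k (i + 1)) - f (τ k i)) = f b - f a := by
  rw [Finset.sum_range_sub (fun i => f (τ k i)), h.left, h.right]

/-- A path that is continuous on `[a, b]` has small increments along fine partitions. -/
theorem IsPartitionSeq.eventually_abs_sub_lt (h : IsPartitionSeq a b n τ) {f : ℝ → ℝ}
    (hf : ContinuousOn f (Set.Icc a b)) {η : ℝ} (hη : 0 < η) :
    ∀ᶠ k in atTop, ∀ i < n k, ∀ u ∈ Set.Icc (τ k i) (τ k (i + 1)),
      ∀ v ∈ Set.Icc (τ k i) (τ k (i + 1)), |f u - f v| < η := by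
  obtain ⟨δ, hδ, hfδ⟩ := Metric.uniformContinuousOn_iff.1
    (isCompact_Icc.uniformContinuousOn_of_continuous hf) η hη
  filter_upwards [h.mesh δ hδ] with k hk i hi u hu v hv
  have h1 := h.mem_Icc (k := k) hi.le
  have h2 := h.mem_Icc (k := k) hi
  refine hfδ u ⟨h1.1.trans hu.1, hu.2.trans h2.2⟩ v ⟨h1.1.trans hv.1, hv.2.trans h2.2⟩ ?_
  have := hk i hi
  rw [Real.dist_eq, abs_lt]
  exact ⟨by linarith [hu.1, hv.2], by linarith [hu.2, hv.1]⟩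

/-- Riemann-Stieltjes sums with respect to `h(u) du`. -/
theorem IsPartitionSeq.tendsto_sum_mul_integral (hτ : IsPartitionSeq a b n τ) {f h : ℝ → ℝ}
    (hf : ContinuousOn f (Set.Icc a b)) (hh : IntervalIntegrable h volume a b)
    {θ : ℕ → ℕ → ℝ} (hθ : ∀ k, ∀ i < n k, θ k i ∈ Set.Icc (τ k i) (τ k (i + 1))) :
    Tendsto (fun k => ∑ i ∈ Finset.range (n k), f (θ k i) * ∫ u in τ k i..τ k (i + 1), h u) atTop
      (nhds (∫ u in a..b, f u * h u)) := by
  have hab := hτ.le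
  have hfh : IntervalIntegrable (fun u => f u * h u) volume a b :=
    hh.continuousOn_mul (by rwa [Set.uIcc_of_le hab])
  have hsub : ∀ k, ∀ i < n k, Set.uIcc (τ k i) (τ k (i + 1)) ⊆ Set.uIcc a b := fun k i hi => by
    rw [Set.uIcc_of_le hab, Set.uIcc_of_le (hτ.mono k (Nat.le_succ i))]
    exact Set.Icc_subset_Icc (hτ.mem_Icc hi.le).1 (hτ.mem_Icc hi).2
  have hint : ∀ k, ∀ i < n k, IntervalIntegrable h volume (τ k i) (τ k (i + 1)) :=
    fun k i hi => hh.mono_set (hsub k i hi)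
  have hfint : ∀ k, ∀ i < n k,
      IntervalIntegrable (fun u => f u * h u) volume (τ k i) (τ k (i + 1)) :=
    fun k i hi => hfh.mono_set (hsub k i hi)
  rw [Metric.tendsto_atTop']
  intro ζ hζ
  set S : ℝ := ∫ u in a..b, |h u| with hS
  have hS0 : 0 ≤ S := intervalIntegral.integral_nonneg hab fun _ _ => abs_nonneg _
  obtain ⟨N, hN⟩ := eventually_atTop.1
    (hτ.eventually_abs_sub_lt hf (div_pos hζ (by positivity : 0 < S + 1)))
  refine ⟨N, fun k hk => ?_⟩
  rw [Real.dist_eq, ← hτ.left k, ← hτ.right k,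
    ← intervalIntegral.sum_integral_adjacent_intervals (hfint k), ← Finset.sum_sub_distrib]
  have hle : ∀ i ∈ Finset.range (n k),
      |f (θ k i) * (∫ u in τ k i..τ k (i + 1), h u) - ∫ u in τ k i..τ k (i + 1), f u * h u|
        ≤ ∫ u in τ k i..τ k (i + 1), ζ / (S + 1) * |h u| := by
    intro i hi
    rw [Finset.mem_range] at hi
    have hmono := hτ.mono k (Nat.le_succ i)
    rw [← intervalIntegral.integral_const_mul,
      ← intervalIntegral.integral_sub ((hint k i hi).const_mul _) (hfint k i hi)]
    rw [← Real.norm_eq_abs]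
    refine intervalIntegral.norm_integral_le_of_norm_le hmono (ae_of_all _ fun u hu => ?_)
      ((hint k i hi).abs.const_mul _)
    rw [← sub_mul, norm_mul]
    exact mul_le_mul_of_nonneg_right
      (hN k hk.le i hi _ (hθ k i hi) u (Set.Ioc_subset_Icc_self hu)).le (norm_nonneg _)
  refine (Finset.abs_sum_le_sum_abs _ _).trans_lt ((Finset.sum_le_sum hle).trans_lt ?_)
  rw [intervalIntegral.sum_integral_adjacent_intervals
    (fun i hi => (hint k i hi).abs.const_mul _), hτ.left, hτ.right,
    intervalIntegral.integral_const_mul, ← hS, div_mul_eq_mul_div, div_lt_iff₀ (by positivity)]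
  linarith

end Partition

/-! ### Itô's formula for the logarithm along a single path. -/

section Pathwise

theorem abs_log_one_add_sub_le {x : ℝ} (hx : |x| ≤ 1 / 2) :
    |Real.log (1 + x) - (x - x ^ 2 / 2)| ≤ 2 * |x| ^ 3 := by
  have h1 : |(-x)| < 1 := by rw [abs_neg]; linarith
  have h := Real.abs_log_sub_add_sum_range_le h1 2
  simp only [Finset.sum_range_succ, Finset.sum_range_zero, abs_neg] at h
  have h2 : |x| ^ (2 + 1) / (1 - |x|) ≤ 2 * |x| ^ 3 := by
    rw [div_le_iff₀ (by linarith)]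
    have : 0 ≤ |x| ^ 3 := by positivity
    rw [show 2 + 1 = 3 from rfl]
    nlinarith
  refine le_trans (le_of_eq ?_) (h.trans h2)
  congr 1
  push_cast
  ring_nf

/-- If the array `p` is uniformly small, sums to `A` and has quadratic variation `V`, then
`∑ log (1 + p) → A - V / 2`. -/
theorem tendsto_sum_log_one_add {n : ℕ → ℕ} {p : ℕ → ℕ → ℝ} {A V : ℝ}
    (hsmall : ∀ η : ℝ, 0 < η → ∀ᶠ k in atTop, ∀ i < n k, |p k i| ≤ η)
    (hA : Tendsto (fun k => ∑ i ∈ Finset.range (n k), p k i) atTop (nhds A))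
    (hV : Tendsto (fun k => ∑ i ∈ Finset.range (n k), p k i ^ 2) atTop (nhds V)) :
    Tendsto (fun k => ∑ i ∈ Finset.range (n k), Real.log (1 + p k i)) atTop
      (nhds (A - V / 2)) := by
  have hV0 : 0 ≤ V := ge_of_tendsto' hV fun k => Finset.sum_nonneg fun i _ => sq_nonneg _
  have hmain : Tendsto (fun k => ∑ i ∈ Finset.range (n k), p k i
      - (∑ i ∈ Finset.range (n k), p k i ^ 2) / 2) atTop (nhds (A - V / 2)) :=
    hA.sub (hV.div_const 2)
  refine hmain.congr_dist ?_
  rw [Metric.tendsto_atTop']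
  intro ζ hζ
  have hVev : ∀ᶠ k in atTop, ∑ i ∈ Finset.range (n k), p k i ^ 2 < V + 1 :=
    hV.eventually (gt_mem_nhds (by linarith))
  have hη : 0 < min (1 / 2) (ζ / (4 * (V + 1))) := by positivity
  obtain ⟨N, hN⟩ := eventually_atTop.1 (hVev.and (hsmall _ hη))
  refine ⟨N, fun k hk => ?_⟩
  obtain ⟨h1, h2⟩ := hN k hk.le
  rw [Real.dist_0_eq_abs, abs_of_nonneg dist_nonneg, dist_comm, Real.dist_eq, Finset.sum_div,
    ← Finset.sum_sub_distrib, ← Finset.sum_sub_distrib]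
  refine (Finset.abs_sum_le_sum_abs _ _).trans_lt ?_
  -- The cubic remainder is at most the largest |p| times p². The sums of squares stay bounded, so
  -- the total remainder vanishes.
  have hle : ∀ i ∈ Finset.range (n k), |Real.log (1 + p k i) - (p k i - p k i ^ 2 / 2)|
      ≤ 2 * (ζ / (4 * (V + 1))) * p k i ^ 2 := fun i hi => by
    have h3 := h2 i (Finset.mem_range.1 hi)
    refine (abs_log_one_add_sub_le (h3.trans (min_le_left _ _))).trans ?_
    rw [pow_succ, sq_abs]
    have := h3.trans (min_le_right _ _)
    nlinarith [mul_le_mul_of_nonneg_left this (sq_nonneg (p k i))]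
  refine (Finset.sum_le_sum hle).trans_lt ?_
  rw [← Finset.mul_sum]
  have h4 : 2 * (ζ / (4 * (V + 1))) * (∑ i ∈ Finset.range (n k), p k i ^ 2)
      ≤ 2 * (ζ / (4 * (V + 1))) * (V + 1) := by gcongr
  have h5 : 2 * (ζ / (4 * (V + 1))) * (V + 1) = ζ / 2 := by field_simp; ring
  linarith

/-- Perturbing an array by one with vanishing sum of squares does not change the limit of the
sum of squares. -/
theorem tendsto_sum_sq_add {n : ℕ → ℕ} {x q : ℕ → ℕ → ℝ} {V : ℝ}
    (hx : Tendsto (fun k => ∑ i ∈ Finset.range (n k), x k i ^ 2) atTop (nhds V))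
    (hq : Tendsto (fun k => ∑ i ∈ Finset.range (n k), q k i ^ 2) atTop (nhds 0)) :
    Tendsto (fun k => ∑ i ∈ Finset.range (n k), (x k i + q k i) ^ 2) atTop (nhds V) := by
  have hcross : Tendsto (fun k => ∑ i ∈ Finset.range (n k), x k i * q k i) atTop (nhds 0) := by
    have h := (hx.mul hq).sqrt
    rw [mul_zero, Real.sqrt_zero] at h
    exact squeeze_zero_norm (fun k => Real.abs_le_sqrt (Finset.sum_mul_sq_le_sq_mul_sq _ _ _)) h
  have h := (hx.add (hcross.const_mul 2)).add hq
  rw [mul_zero, add_zero, add_zero] at h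
  refine h.congr fun k => ?_
  rw [Finset.mul_sum, ← Finset.sum_add_distrib, ← Finset.sum_add_distrib]
  exact Finset.sum_congr rfl fun i _ => by ring

end Pathwise

section Pathwise

/-- Itô's formula for `log R` along a path, given the vanishing of the stochastic error terms. -/
theorem log_sub_log_eq_of_tendsto {a b σ C : ℝ} {n : ℕ → ℕ} {τ : ℕ → ℕ → ℝ}
    (hτ : IsPartitionSeq a b n τ) {R β m I : ℝ → ℝ}
    (hR : ContinuousOn R (Set.Icc a b)) (hpos : ∀ s ∈ Set.Icc a b, 0 < R s)
    (hm : Measurable m) (hC : ∀ s, |m s| ≤ C)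
    (hsde : ∀ k, ∀ i ≤ n k,
      R (τ k i) = R a + (∫ u in a..τ k i, R u * m u) + σ * I (τ k i))
    (herr : Tendsto (fun k => ∑ i ∈ Finset.range (n k),
      (I (τ k (i + 1)) - I (τ k i) - R (τ k i) * (β (τ k (i + 1)) - β (τ k i))) / R (τ k i))
      atTop (nhds 0))
    (herr2 : Tendsto (fun k => ∑ i ∈ Finset.range (n k),
      (I (τ k (i + 1)) - I (τ k i) - R (τ k i) * (β (τ k (i + 1)) - β (τ k i))) ^ 2)
      atTop (nhds 0))
    (hqv : Tendsto (fun k => ∑ i ∈ Finset.range (n k), (β (τ k (i + 1)) - β (τ k i)) ^ 2)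
      atTop (nhds (b - a))) :
    Real.log (R b) - Real.log (R a)
      = (∫ u in a..b, m u) + σ * (β b - β a) - σ ^ 2 * (b - a) / 2 := by
  have hab := hτ.le
  obtain ⟨x₀, hx₀, hmin⟩ := isCompact_Icc.exists_isMinOn ⟨a, Set.left_mem_Icc.2 hab⟩ hR
  set c := R x₀ with hc
  have hc0 : 0 < c := hpos x₀ hx₀
  have hcR : ∀ s ∈ Set.Icc a b, c ≤ R s := fun s hs => hmin hs
  have hRm : IntervalIntegrable (fun u => R u * m u) volume a b :=
    (intervalIntegrable_of_bound hm hC a b).continuousOn_mul (by rwa [Set.uIcc_of_le hab])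
  have hRm' : ∀ k, ∀ i ≤ n k, IntervalIntegrable (fun u => R u * m u) volume a (τ k i) :=
    fun k i hi => hRm.mono_set (by
      rw [Set.uIcc_of_le hab, Set.uIcc_of_le (hτ.mem_Icc hi).1]
      exact Set.Icc_subset_Icc_right (hτ.mem_Icc hi).2)
  set F : ℝ → ℝ := fun s => ∫ u in a..s, R u * m u with hF
  have hFc : ContinuousOn F (Set.Icc a b) := by
    have := intervalIntegral.continuousOn_primitive_interval' hRm (Set.left_mem_uIcc)
    rwa [Set.uIcc_of_le hab] at this
  set D : ℕ → ℕ → ℝ := fun k i => ∫ u in τ k i..τ k (i + 1), R u * m u with hD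
  have hDF : ∀ k, ∀ i < n k, D k i = F (τ k (i + 1)) - F (τ k i) := fun k i hi =>
    (intervalIntegral.integral_interval_sub_left (hRm' k _ hi) (hRm' k _ hi.le)).symm
  set e : ℕ → ℕ → ℝ := fun k i =>
    I (τ k (i + 1)) - I (τ k i) - R (τ k i) * (β (τ k (i + 1)) - β (τ k i)) with he
  set p : ℕ → ℕ → ℝ := fun k i => (R (τ k (i + 1)) - R (τ k i)) / R (τ k i) with hp
  have hleft : ∀ k, ∀ i < n k, τ k i ∈ Set.Icc (τ k i) (τ k (i + 1)) := fun k i _ =>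
    Set.left_mem_Icc.2 (hτ.mono k (Nat.le_succ i))
  have hright : ∀ k, ∀ i < n k, τ k (i + 1) ∈ Set.Icc (τ k i) (τ k (i + 1)) := fun k i _ =>
    Set.right_mem_Icc.2 (hτ.mono k (Nat.le_succ i))
  -- Relative increment = noise + (drift + integral error). Only the noise contributes to the
  -- quadratic variation; the bracket contributes the drift to the sum itself.
  have hdec : ∀ k, ∀ i < n k, p k i = σ * (β (τ k (i + 1)) - β (τ k i))
      + ((R (τ k i))⁻¹ * D k i + σ * (e k i / R (τ k i))) := fun k i hi => by
    have h0 := (hpos _ (hτ.mem_Icc (k := k) hi.le)).ne'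
    have h1 : R (τ k (i + 1)) - R (τ k i) = D k i + σ * (I (τ k (i + 1)) - I (τ k i)) := by
      have h2 := hsde k (i + 1) hi
      have h3 := hsde k i hi.le
      rw [hDF k i hi]
      linarith
    simp only [hp, h1, he]
    field_simp
    ring
  have hsum1 : Tendsto (fun k => ∑ i ∈ Finset.range (n k), (R (τ k i))⁻¹ * D k i) atTop
      (nhds (∫ u in a..b, m u)) := by
    have h := hτ.tendsto_sum_mul_integral (hR.inv₀ fun s hs => (hpos s hs).ne') hRm hleft
    have h1 : ∫ u in a..b, R⁻¹ u * (R u * m u) = ∫ u in a..b, m u := by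
      refine intervalIntegral.integral_congr fun u hu => ?_
      rw [Set.uIcc_of_le hab] at hu
      exact inv_mul_cancel_left₀ (hpos u hu).ne' _
    rw [h1] at h
    exact h
  have hA : Tendsto (fun k => ∑ i ∈ Finset.range (n k), p k i) atTop
      (nhds (σ * (β b - β a) + ((∫ u in a..b, m u) + σ * 0))) := by
    refine (tendsto_const_nhds.add (hsum1.add (herr.const_mul σ))).congr fun k => ?_
    rw [← hτ.sum_sub β k, Finset.mul_sum, Finset.mul_sum, ← Finset.sum_add_distrib,
      ← Finset.sum_add_distrib]
    exact Finset.sum_congr rfl fun i hi => (hdec k i (Finset.mem_range.1 hi)).symm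
  -- D² is D times the increment of F, so this sum is the difference of the right- and left-endpoint
  -- sums for ∫ F dF, which have the same limit.
  have hD2 : Tendsto (fun k => ∑ i ∈ Finset.range (n k), D k i ^ 2) atTop (nhds 0) := by
    have h := (hτ.tendsto_sum_mul_integral hFc hRm hright).sub
      (hτ.tendsto_sum_mul_integral hFc hRm hleft)
    rw [sub_self] at h
    refine h.congr fun k => ?_
    rw [← Finset.sum_sub_distrib]
    refine Finset.sum_congr rfl fun i hi => ?_
    rw [← sub_mul, ← hDF k i (Finset.mem_range.1 hi), sq]
  have hq2 : Tendsto (fun k => ∑ i ∈ Finset.range (n k),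
      ((R (τ k i))⁻¹ * D k i + σ * (e k i / R (τ k i))) ^ 2) atTop (nhds 0) := by
    have h := (hD2.add (herr2.const_mul (σ ^ 2))).const_mul (2 / c ^ 2)
    rw [mul_zero, add_zero, mul_zero] at h
    refine squeeze_zero (fun k => Finset.sum_nonneg fun i _ => sq_nonneg _) (fun k => ?_) h
    rw [Finset.mul_sum, ← Finset.sum_add_distrib, Finset.mul_sum]
    refine Finset.sum_le_sum fun i hi => ?_
    have hci := hcR _ (hτ.mem_Icc (k := k) (Finset.mem_range.1 hi).le)
    have h1 : ((R (τ k i))⁻¹ * D k i + σ * (e k i / R (τ k i))) ^ 2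
        = (D k i + σ * e k i) ^ 2 / R (τ k i) ^ 2 := by
      have := (hc0.trans_le hci).ne'
      field_simp
    rw [h1]
    calc (D k i + σ * e k i) ^ 2 / R (τ k i) ^ 2
        ≤ (2 * (D k i ^ 2 + σ ^ 2 * e k i ^ 2)) / c ^ 2 := by
          gcongr
          nlinarith [sq_nonneg (D k i - σ * e k i)]
      _ = 2 / c ^ 2 * (D k i ^ 2 + σ ^ 2 * e k i ^ 2) := by ring
  have hV : Tendsto (fun k => ∑ i ∈ Finset.range (n k), p k i ^ 2) atTop
      (nhds (σ ^ 2 * (b - a))) := by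
    have h : Tendsto (fun k => ∑ i ∈ Finset.range (n k),
        (σ * (β (τ k (i + 1)) - β (τ k i))) ^ 2) atTop (nhds (σ ^ 2 * (b - a))) := by
      refine (hqv.const_mul (σ ^ 2)).congr fun k => ?_
      rw [Finset.mul_sum]
      exact Finset.sum_congr rfl fun i _ => by ring
    refine (tendsto_sum_sq_add h hq2).congr fun k => ?_
    exact Finset.sum_congr rfl fun i hi => by rw [hdec k i (Finset.mem_range.1 hi)]
  have hsmall : ∀ η : ℝ, 0 < η → ∀ᶠ k in atTop, ∀ i < n k, |p k i| ≤ η := fun η hη => by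
    filter_upwards [hτ.eventually_abs_sub_lt hR (mul_pos hη hc0)] with k hk i hi
    have hci := hcR _ (hτ.mem_Icc (k := k) hi.le)
    simp only [hp]
    rw [abs_div, abs_of_pos (hc0.trans_le hci), div_le_iff₀ (hc0.trans_le hci)]
    exact (hk i hi _ (hright k i hi) _ (hleft k i hi)).le.trans (by gcongr)
  have hlog := tendsto_sum_log_one_add hsmall hA hV
  -- 1 + p is the ratio of consecutive values of R, so the sum telescopes and does not depend on k.
  -- Its limit is therefore its value.
  have hconst : ∀ k, ∑ i ∈ Finset.range (n k), Real.log (1 + p k i)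
      = Real.log (R b) - Real.log (R a) := fun k => by
    rw [← hτ.sum_sub (fun s => Real.log (R s)) k]
    refine Finset.sum_congr rfl fun i hi => ?_
    have h0 := (hpos _ (hτ.mem_Icc (k := k) (Finset.mem_range.1 hi).le)).ne'
    have h1 := (hpos _ (hτ.mem_Icc (k := k) (Finset.mem_range.1 hi))).ne'
    rw [← Real.log_div h1 h0]
    congr 1
    simp only [hp]
    field_simp
    ring
  simp only [hconst] at hlog
  rw [tendsto_nhds_unique tendsto_const_nhds hlog]
  ring

end Pathwise

/-! ### The pathwise Hamilton-Jacobi-Bellman argument. -/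

section Verification

variable {γ ρ σ ε T t : ℝ} {ψ m : ℝ → ℝ}

/-- The Hamilton-Jacobi-Bellman identity along a deterministic path. -/
theorem SolvesODE.integral_eq (hψ : SolvesODE γ ρ σ ε T ψ) (ht : t ∈ Set.Icc 0 T)
    (hm : Measurable m) (hC : ∀ s, |m s| ≤ ε) :
    ∫ s in t..T, Real.exp ((σ ^ 2 / 2 * γ * (γ - 1) - ρ) * s)
        * ((1 - m s) + (ε * |γ * ψ s - 1| - (γ * ψ s - 1) * m s))
        * Real.exp (∫ u in t..s, γ * m u)
      = Real.exp ((σ ^ 2 / 2 * γ * (γ - 1) - ρ) * t) * ψ t := by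
  -- κ is the coefficient of the linear terms of the equation for ψ. The integrating factor e^{κs}
  -- cancels them, leaving only 1, the absolute value and the term produced by the control.
  set κ := σ ^ 2 / 2 * γ * (γ - 1) - ρ with hκ
  have hsub : Set.Icc t T ⊆ Set.Icc 0 T := Set.Icc_subset_Icc_left ht.1
  have hg : ∀ s ∈ Set.Icc t T, HasDerivWithinAt (fun s => Real.exp (κ * s) * ψ s)
      (Real.exp (κ * s) * (κ * ψ s - odeField γ ρ σ ε (ψ s))) (Set.Icc t T) s := fun s hs => by
    have h1 : HasDerivAt (fun s => Real.exp (κ * s)) (Real.exp (κ * s) * κ) s := by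
      simpa using ((hasDerivAt_id s).const_mul κ).exp
    refine (h1.hasDerivWithinAt.mul ((hψ.hasDerivWithinAt (hsub hs)).mono hsub)).congr_deriv ?_
    ring
  have hψc := hψ.continuousOn.mono hsub
  have hg' : ContinuousOn (fun s => Real.exp (κ * s) * (κ * ψ s - odeField γ ρ σ ε (ψ s)))
      (Set.Icc t T) := by
    unfold odeField
    fun_prop
  have h := integral_deriv_add_mul_mul_exp_integral ht.2 hg hg' (hm.const_mul γ)
    (C := |γ| * ε) (fun s => by rw [abs_mul]; exact mul_le_mul_of_nonneg_left (hC s) (abs_nonneg _))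
  rw [hψ.terminal, mul_zero, zero_mul, zero_sub] at h
  rw [← neg_eq_iff_eq_neg.2 h, ← intervalIntegral.integral_neg]
  refine intervalIntegral.integral_congr fun s _ => ?_
  simp only [odeField, hκ]
  ring

/-- Drop from `SolvesODE.integral_eq` the term ε|γψ - 1| - (γψ - 1)m, nonnegative because |m| ≤ ε.
-/
theorem SolvesODE.integral_le (hψ : SolvesODE γ ρ σ ε T ψ) (ht : t ∈ Set.Icc 0 T)
    (hm : Measurable m) (hC : ∀ s, |m s| ≤ ε) :
    ∫ s in t..T, Real.exp ((σ ^ 2 / 2 * γ * (γ - 1) - ρ) * s) * (1 - m s)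
        * Real.exp (∫ u in t..s, γ * m u)
      ≤ Real.exp ((σ ^ 2 / 2 * γ * (γ - 1) - ρ) * t) * ψ t := by
  have hψc := hψ.continuousOn.mono (Set.Icc_subset_Icc_left ht.1)
  have hAc : Continuous fun s => ∫ u in t..s, γ * m u :=
    (lipschitzWith_integral (hm.const_mul γ) (C := |γ| * ε) (fun s => by
      rw [abs_mul]; exact mul_le_mul_of_nonneg_left (hC s) (abs_nonneg _)) t).continuous
  have hmi := intervalIntegrable_of_bound hm hC t T
  rw [← hψ.integral_eq ht hm hC]
  refine intervalIntegral.integral_mono_on ht.2 ?_ ?_ fun s _ => ?_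
  · exact (((intervalIntegrable_const (c := (1 : ℝ))).sub hmi).continuousOn_mul
      (by fun_prop)).mul_continuousOn (by fun_prop)
  · refine ((((intervalIntegrable_const (c := (1 : ℝ))).sub hmi).add (IntervalIntegrable.sub ?_
      (hmi.continuousOn_mul ?_))).continuousOn_mul (by fun_prop)).mul_continuousOn (by fun_prop)
    · refine ContinuousOn.intervalIntegrable ?_
      rw [Set.uIcc_of_le ht.2]
      fun_prop
    · rw [Set.uIcc_of_le ht.2]
      fun_prop
  · have h1 : (γ * ψ s - 1) * m s ≤ ε * |γ * ψ s - 1| := by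
      refine (le_abs_self _).trans ?_
      rw [abs_mul, mul_comm ε]
      exact mul_le_mul_of_nonneg_left (hC s) (abs_nonneg _)
    gcongr
    linarith

theorem SolvesODE.integral_eq_of_bangBang (hψ : SolvesODE γ ρ σ ε T ψ) (ht : t ∈ Set.Icc 0 T)
    (hm : Measurable m) (hC : ∀ s, |m s| ≤ ε) (hbb : ∀ s ∈ Set.Icc t T, m s = bangBang γ ε ψ s) :
    ∫ s in t..T, Real.exp ((σ ^ 2 / 2 * γ * (γ - 1) - ρ) * s) * (1 - m s)
        * Real.exp (∫ u in t..s, γ * m u)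
      = Real.exp ((σ ^ 2 / 2 * γ * (γ - 1) - ρ) * t) * ψ t := by
  rw [← hψ.integral_eq ht hm hC]
  refine intervalIntegral.integral_congr fun s hs => ?_
  rw [Set.uIcc_of_le ht.2] at hs
  have h : ε * |γ * ψ s - 1| - (γ * ψ s - 1) * m s = 0 := by
    rw [hbb s hs, bangBang]
    rcases lt_trichotomy (γ * ψ s - 1) 0 with h | h | h
    · rw [Real.sign_of_neg h, abs_of_neg h]; ring
    · rw [h]; simp
    · rw [Real.sign_of_pos h, abs_of_pos h]; ring
  simp only [h, add_zero]

theorem abs_bangBang_le (hε : 0 < ε) (s : ℝ) : |bangBang γ ε ψ s| ≤ ε := by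
  rw [bangBang, abs_mul, abs_of_pos hε]
  rcases Real.sign_apply_eq (γ * ψ s - 1) with h | h | h <;> simp [h, hε.le]

end Verification

/-! ### Orthogonality of sums of independent centered increments with adapted weights. -/

section Orthogonality

theorem integrable_fun_sub {α : Type*} {mα : MeasurableSpace α} {ν : Measure α} {f g : α → ℝ}
    (hf : Integrable f ν) (hg : Integrable g ν) : Integrable (fun x => f x - g x) ν :=
  hf.sub hg

/-- Pythagoras for sums `∑ ξ i * d i` of increments `d i` that are centered and independent of the
past, weighted by predictable factors `ξ i`. -/
theorem memLp_and_integral_sq_sum_mul {P : Measure Ω} [IsProbabilityMeasure P]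
    (𝓖 : ℕ → MeasurableSpace Ω) (hmono : Monotone 𝓖)
    (ξ d : ℕ → Ω → ℝ) (n : ℕ)
    (hξ : ∀ i < n, Measurable[𝓖 i] (ξ i)) (hξ2 : ∀ i < n, MemLp (ξ i) 2 P)
    (hd : ∀ i < n, Measurable[𝓖 (i + 1)] (d i)) (hd2 : ∀ i < n, MemLp (d i) 2 P)
    (hind : ∀ i < n, Indep (MeasurableSpace.comap (d i) inferInstance) (𝓖 i) P)
    (hd0 : ∀ i < n, ∫ ω, d i ω ∂P = 0) :
    MemLp (fun ω => ∑ i ∈ Finset.range n, ξ i ω * d i ω) 2 P ∧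
      ∫ ω, (∑ i ∈ Finset.range n, ξ i ω * d i ω) ^ 2 ∂P
        = ∑ i ∈ Finset.range n, (∫ ω, ξ i ω ^ 2 ∂P) * ∫ ω, d i ω ^ 2 ∂P := by
  induction n with
  | zero => simp
  | succ n ih =>
    obtain ⟨ihL, ihI⟩ := ih (fun i hi => hξ i (by omega)) (fun i hi => hξ2 i (by omega))
      (fun i hi => hd i (by omega)) (fun i hi => hd2 i (by omega)) (fun i hi => hind i (by omega))
      (fun i hi => hd0 i (by omega))
    set S : Ω → ℝ := fun ω => ∑ i ∈ Finset.range n, ξ i ω * d i ω with hS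
    have hn := Nat.lt_succ_self n
    have hSm : Measurable[𝓖 n] S := by
      refine Finset.measurable_fun_sum _ fun i hi => ?_
      have hi' := Finset.mem_range.1 hi
      exact ((hξ i (by omega)).mono (hmono hi'.le) le_rfl).mul
        ((hd i (by omega)).mono (hmono hi') le_rfl)
    have hindf : ∀ {X : Ω → ℝ} {φ : ℝ → ℝ}, Measurable[𝓖 n] X → Measurable φ →
        IndepFun X (fun ω => φ (d n ω)) P := fun {X φ} hX hφ => by
      have h1 : IndepFun (d n) X P :=
        indep_of_indep_of_le_right (hind n hn) hX.comap_le
      exact (h1.comp hφ measurable_id).symm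
    have hSξ : Integrable (fun ω => S ω * ξ n ω) P := ihL.integrable_mul (hξ2 n hn)
    have hdi : Integrable (d n) P := (hd2 n hn).integrable (by norm_num)
    have hi1 : IndepFun (fun ω => S ω * ξ n ω) (fun ω => d n ω) P :=
      hindf (φ := id) (hSm.mul (hξ n hn)) measurable_id
    have hi2 : IndepFun (fun ω => ξ n ω ^ 2) (fun ω => d n ω ^ 2) P :=
      hindf (φ := fun x => x ^ 2) ((hξ n hn).pow_const 2) (by fun_prop)
    have hint1 : Integrable (fun ω => S ω * ξ n ω * d n ω) P := hi1.integrable_mul hSξ hdi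
    have hint2 : Integrable (fun ω => ξ n ω ^ 2 * d n ω ^ 2) P :=
      hi2.integrable_mul (hξ2 n hn).integrable_sq (hd2 n hn).integrable_sq
    have hmul : MemLp (fun ω => ξ n ω * d n ω) 2 P := by
      rw [memLp_two_iff_integrable_sq]
      · simpa only [mul_pow] using hint2
      · exact (hξ2 n hn).aestronglyMeasurable.mul (hd2 n hn).aestronglyMeasurable
    simp only [Finset.sum_range_succ]
    refine ⟨ihL.add hmul, ?_⟩
    have hexp : ∀ ω, (S ω + ξ n ω * d n ω) ^ 2
        = S ω ^ 2 + 2 * (S ω * ξ n ω * d n ω) + ξ n ω ^ 2 * d n ω ^ 2 := fun ω => by ring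
    -- The cross term vanishes: S ξ_n belongs to the past, of which the centered increment d_n is
    -- independent.
    have e1 : ∫ ω, S ω * ξ n ω * d n ω ∂P = 0 := by
      rw [hi1.integral_fun_mul_eq_mul_integral hSξ.aestronglyMeasurable
        hdi.aestronglyMeasurable, hd0 n hn, mul_zero]
    change ∫ ω, (S ω + ξ n ω * d n ω) ^ 2 ∂P = _
    simp only [hexp]
    rw [integral_add (ihL.integrable_sq.fun_add (hint1.const_mul 2)) hint2,
      integral_add ihL.integrable_sq (hint1.const_mul 2), integral_const_mul, e1,
      hi2.integral_fun_mul_eq_mul_integral (hξ2 n hn).integrable_sq.aestronglyMeasurable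
        (hd2 n hn).integrable_sq.aestronglyMeasurable, ihI]
    ring

end Orthogonality

/-! ### Gaussian moments. -/

section Gaussian

theorem memLp_sq_sub_gaussianReal (v : ℝ≥0) (c : ℝ) :
    MemLp (fun x : ℝ => x ^ 2 - c) 2 (gaussianReal 0 v) := by
  have h : MemLp (fun x : ℝ => x) 4 (gaussianReal 0 v) := memLp_id_gaussianReal 4
  have : ENNReal.HolderTriple 4 4 2 := ⟨by
    rw [show (4 : ENNReal) = 2 * 2 by norm_num, ENNReal.mul_inv (by simp) (by simp), ← two_mul,
      ← mul_assoc, ENNReal.mul_inv_cancel (by simp) (by simp), one_mul]⟩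
  have h2 : MemLp (fun x : ℝ => x * x) 2 (gaussianReal 0 v) := h.mul h
  have h3 : MemLp (fun x : ℝ => x * x - c) 2 (gaussianReal 0 v) := h2.sub (memLp_const c)
  simpa only [sq] using h3

theorem integral_sq_sub_gaussianReal (v : ℝ≥0) :
    ∫ x, (x ^ 2 - v) ∂(gaussianReal 0 v) = 0 := by
  have hi : Integrable (fun x : ℝ => x ^ 2) (gaussianReal 0 v) :=
    (memLp_id_gaussianReal 2).integrable_sq
  rw [integral_sub hi (integrable_const _)]
  have h := variance_eq_integral (X := id) (μ := gaussianReal 0 v) measurable_id.aemeasurable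
  simp only [variance_id_gaussianReal, id, integral_id_gaussianReal] at h
  simp [h]

theorem integral_sq_gaussianReal (v : ℝ≥0) : ∫ x, x ^ 2 ∂(gaussianReal 0 v) = v := by
  have h := variance_eq_integral (X := id) (μ := gaussianReal 0 v) measurable_id.aemeasurable
  simp only [variance_id_gaussianReal, id, integral_id_gaussianReal] at h
  simp [h]

theorem integral_sq_sq_sub_gaussianReal (v : ℝ≥0) :
    ∫ x, (x ^ 2 - v) ^ 2 ∂(gaussianReal 0 v)
      = v ^ 2 * ∫ x, (x ^ 2 - 1) ^ 2 ∂(gaussianReal 0 1) := by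
  have h : (gaussianReal 0 1).map (fun x => √v * x) = gaussianReal 0 v := by
    rw [gaussianReal_map_const_mul]
    congr 1
    · simp
    · ext
      simp
  rw [← h, integral_map (by fun_prop) (by fun_prop), ← integral_const_mul]
  refine integral_congr_ae (ae_of_all _ fun x => ?_)
  simp only [mul_pow, Real.sq_sqrt v.coe_nonneg]
  ring

theorem integral_exp_mul_gaussianReal (v : ℝ≥0) (c : ℝ) :
    ∫ x, Real.exp (c * x) ∂(gaussianReal 0 v) = Real.exp (v * c ^ 2 / 2) := by
  have h := mgf_gaussianReal (p := gaussianReal 0 v) (X := id) (μ := 0) (v := v) (by simp) c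
  simpa [mgf] using h

/-- This is the derivative at c of the moment generating function, computed in two ways. -/
theorem integral_mul_exp_mul_gaussianReal (v : ℝ≥0) (c : ℝ) :
    ∫ x, x * Real.exp (c * x) ∂(gaussianReal 0 v) = v * c * Real.exp (v * c ^ 2 / 2) := by
  have h1 : HasDerivAt (mgf id (gaussianReal 0 v)) _ c := hasDerivAt_mgf (by simp)
  have h2 : mgf id (gaussianReal 0 v) = fun c => Real.exp (v * c ^ 2 / 2) := by
    funext c
    simpa using mgf_gaussianReal (p := gaussianReal 0 v) (X := id) (μ := 0) (v := v) (by simp) c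
  rw [h2] at h1
  have h3 : HasDerivAt (fun c : ℝ => Real.exp (v * c ^ 2 / 2)) (v * c * Real.exp (v * c ^ 2 / 2))
      c := by
    refine ((((hasDerivAt_pow 2 c).const_mul (v : ℝ)).div_const 2).exp).congr_deriv ?_
    simp
    ring
  exact h1.unique h3

theorem memLp_exp_mul_gaussianReal (v : ℝ≥0) (c : ℝ) :
    MemLp (fun x : ℝ => Real.exp (c * x)) 2 (gaussianReal 0 v) := by
  rw [memLp_two_iff_integrable_sq (by fun_prop)]
  refine (integrable_exp_mul_gaussianReal (μ := 0) (v := v) (2 * c)).congr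
    (ae_of_all _ fun x => ?_)
  simp only
  rw [← Real.exp_nat_mul]
  push_cast
  ring_nf

/-- The error `(e^{σ x - σ² v / 2} - 1) / σ - x` of the first-order expansion of the exponential
martingale. -/
noncomputable def expError (σ v x : ℝ) : ℝ := (Real.exp (σ * x - σ ^ 2 * v / 2) - 1) / σ - x

@[fun_prop]
theorem continuous_expError (σ v : ℝ) : Continuous (expError σ v) := by
  unfold expError
  fun_prop

theorem expError_eq (σ v x : ℝ) :
    expError σ v x = Real.exp (-(σ ^ 2 * v / 2)) / σ * Real.exp (σ * x) - 1 / σ - x := by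
  rw [expError, sub_eq_add_neg (σ * x), Real.exp_add]
  ring

theorem memLp_expError (σ : ℝ) (v : ℝ≥0) : MemLp (expError σ v) 2 (gaussianReal 0 v) := by
  have h := (((memLp_exp_mul_gaussianReal v σ).const_mul
    (Real.exp (-(σ ^ 2 * v / 2)) / σ)).sub (memLp_const (1 / σ))).sub
    (memLp_id_gaussianReal (μ := 0) (v := v) 2)
  refine h.congr_norm (by fun_prop) (ae_of_all _ fun x => ?_)
  simp [expError_eq]

theorem integral_expError {σ : ℝ} (v : ℝ≥0) :
    ∫ x, expError σ v x ∂(gaussianReal 0 v) = 0 := by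
  have h1 := (memLp_exp_mul_gaussianReal v σ).integrable (by norm_num)
  have h2 : Integrable (fun x : ℝ => x) (gaussianReal 0 v) :=
    (memLp_id_gaussianReal (μ := 0) (v := v) 2).integrable (by norm_num)
  simp only [expError_eq]
  rw [integral_sub (integrable_fun_sub (h1.const_mul _) (integrable_const _)) h2,
    integral_sub (h1.const_mul _) (integrable_const _), integral_const_mul,
    integral_exp_mul_gaussianReal, integral_id_gaussianReal, div_mul_eq_mul_div, ← Real.exp_add]
  simp only [integral_const, probReal_univ, smul_eq_mul, one_mul, sub_zero]
  rw [show -(σ ^ 2 * (v : ℝ) / 2) + v * σ ^ 2 / 2 = 0 by ring, Real.exp_zero, sub_self]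

/-- The point of this value is that it is of order v² as v → 0. Summed over a partition it is
controlled by the sum of squared step lengths, which tends to zero. -/
theorem integral_expError_sq {σ : ℝ} (hσ : σ ≠ 0) (v : ℝ≥0) :
    ∫ x, expError σ v x ^ 2 ∂(gaussianReal 0 v)
      = (Real.exp (σ ^ 2 * v) - 1 - σ ^ 2 * v) / σ ^ 2 := by
  have h1 := memLp_exp_mul_gaussianReal v σ
  have h2 : MemLp (fun x : ℝ => x) 2 (gaussianReal 0 v) := memLp_id_gaussianReal 2
  have h0 := integral_expError (σ := σ) v
  have hL := memLp_expError σ v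
  set k := Real.exp (-(σ ^ 2 * v / 2)) with hk
  have h3 := (integrable_exp_mul_gaussianReal (μ := 0) (v := v) (2 * σ))
  have h4 : Integrable (fun x : ℝ => x * Real.exp (σ * x)) (gaussianReal 0 v) :=
    h2.integrable_mul h1
  have hexp : ∀ x, expError σ v x ^ 2 = k ^ 2 / σ ^ 2 * Real.exp (2 * σ * x)
      - 2 * k / σ * (x * Real.exp (σ * x)) + x ^ 2 - 2 / σ * (expError σ v x) - 1 / σ ^ 2 := fun x => by
    rw [expError_eq, show 2 * σ * x = σ * x + σ * x by ring, Real.exp_add, ← hk]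
    field_simp
    ring
  have i1 := h3.const_mul (k ^ 2 / σ ^ 2)
  have i2 := h4.const_mul (2 * k / σ)
  have i3 := h2.integrable_sq
  have i4 := (hL.integrable (by norm_num)).const_mul (2 / σ)
  have i5 : Integrable (fun _ : ℝ => 1 / σ ^ 2) (gaussianReal 0 v) := integrable_const _
  simp only [hexp]
  rw [integral_sub (integrable_fun_sub ((integrable_fun_sub i1 i2).fun_add i3) i4) i5,
    integral_sub ((integrable_fun_sub i1 i2).fun_add i3) i4,
    integral_add (integrable_fun_sub i1 i2) i3, integral_sub i1 i2]
  simp only [integral_const_mul]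
  rw [h0, integral_exp_mul_gaussianReal, integral_mul_exp_mul_gaussianReal,
    integral_sq_gaussianReal]
  simp only [integral_const, probReal_univ, smul_eq_mul, one_mul]
  have e1 : k * Real.exp (v * σ ^ 2 / 2) = 1 := by
    rw [hk, ← Real.exp_add, ← Real.exp_zero]
    congr 1
    ring
  have e2 : k ^ 2 * Real.exp (v * (2 * σ) ^ 2 / 2) = Real.exp (σ ^ 2 * v) := by
    rw [hk, ← Real.exp_nat_mul, ← Real.exp_add]
    congr 1
    push_cast
    ring
  have e3 : k ^ 2 / σ ^ 2 * Real.exp (v * (2 * σ) ^ 2 / 2) = Real.exp (σ ^ 2 * v) / σ ^ 2 := by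
    rw [← e2]; ring
  have e4 : 2 * k / σ * (v * σ * Real.exp (v * σ ^ 2 / 2)) = 2 * v := by
    calc _ = 2 * v * (k * Real.exp (v * σ ^ 2 / 2)) * (σ / σ) := by ring
      _ = _ := by rw [e1, div_self hσ]; ring
  rw [e3, e4]
  field_simp
  ring

end Gaussian

/-! ### Brownian increments: law, independence of the past, second moments of weighted sums. -/

section Brownian

/-- The increment of `B` over `[a, b]`. -/
abbrev incr (B : ℝ≥0 → Ω → ℝ) (a b : ℝ) (ω : Ω) : ℝ := B b.toNNReal ω - B a.toNNReal ω

variable {P : Measure Ω} {𝓕 : Filtration ℝ≥0 mΩ} {B : ℝ≥0 → Ω → ℝ} {a b : ℝ}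

theorem IsBrownianMotion.hasLaw_incr (hB : IsBrownianMotion P 𝓕 B) (ha : 0 ≤ a) (hab : a ≤ b) :
    HasLaw (incr B a b) (gaussianReal 0 (b - a).toNNReal) P := by
  have h := hB.isBrownianReal.toIsPreBrownianReal.hasLaw_sub b.toNNReal a.toNNReal
  suffices hv : (b - a).toNNReal = nndist (b.toNNReal : ℝ) (a.toNNReal : ℝ) by rw [hv]; exact h
  refine NNReal.eq ?_
  have h1 : ((b.toNNReal : ℝ≥0) : ℝ) = b := Real.coe_toNNReal _ (ha.trans hab)
  have h2 : ((a.toNNReal : ℝ≥0) : ℝ) = a := Real.coe_toNNReal _ ha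
  rw [coe_nndist]
  change _ = dist (b.toNNReal : ℝ) (a.toNNReal : ℝ)
  rw [h1, h2, Real.coe_toNNReal _ (sub_nonneg.2 hab), Real.dist_eq, abs_of_nonneg (sub_nonneg.2 hab)]

theorem IsBrownianMotion.measurable_incr (hB : IsBrownianMotion P 𝓕 B) (hab : a ≤ b) :
    Measurable[𝓕 b.toNNReal] (incr B a b) :=
  (hB.adapted _).sub ((hB.adapted _).mono (𝓕.mono (Real.toNNReal_le_toNNReal hab)) le_rfl)

theorem IsBrownianMotion.measurable_incr' (hB : IsBrownianMotion P 𝓕 B) (a b : ℝ) :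
    Measurable (incr B a b) :=
  ((hB.adapted _).mono (𝓕.le _) le_rfl).sub ((hB.adapted _).mono (𝓕.le _) le_rfl)

theorem IsBrownianMotion.indep_comp_incr (hB : IsBrownianMotion P 𝓕 B) (hab : a ≤ b) {φ : ℝ → ℝ}
    (hφ : Measurable φ) :
    Indep (MeasurableSpace.comap (fun ω => φ (incr B a b ω)) inferInstance) (𝓕 a.toNNReal) P := by
  refine indep_of_indep_of_le_left
    (hB.indep_increments _ _ (Real.toNNReal_le_toNNReal hab)) ?_
  rw [show (fun ω => φ (incr B a b ω)) = φ ∘ (incr B a b) from rfl, ← MeasurableSpace.comap_comp]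
  exact MeasurableSpace.comap_mono hφ.comap_le

theorem IsBrownianMotion.memLp_comp_incr (hB : IsBrownianMotion P 𝓕 B) (ha : 0 ≤ a) (hab : a ≤ b)
    {φ : ℝ → ℝ} (hφ : MemLp φ 2 (gaussianReal 0 (b - a).toNNReal)) :
    MemLp (fun ω => φ (incr B a b ω)) 2 P := by
  have h := hB.hasLaw_incr ha hab
  rw [← h.map_eq] at hφ
  exact hφ.comp_of_map h.aemeasurable

theorem IsBrownianMotion.integral_comp_incr (hB : IsBrownianMotion P 𝓕 B) (ha : 0 ≤ a)
    (hab : a ≤ b) {φ : ℝ → ℝ} (hφ : Measurable φ) :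
    ∫ ω, φ (incr B a b ω) ∂P = ∫ x, φ x ∂(gaussianReal 0 (b - a).toNNReal) :=
  (hB.hasLaw_incr ha hab).integral_comp hφ.aestronglyMeasurable

/-- The second moment of sums `∑ ξ_i φ_i(B_{τ (i+1)} - B_{τ i})` with adapted factors `ξ_i` and
centered `φ_i`. -/
theorem IsBrownianMotion.memLp_and_integral_sq_sum [IsProbabilityMeasure P]
    (hB : IsBrownianMotion P 𝓕 B) {τ : ℕ → ℝ}
    (hτ : Monotone τ) (hτ0 : 0 ≤ τ 0) (n : ℕ) (ξ : ℕ → Ω → ℝ) (φ : ℕ → ℝ → ℝ)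
    (hξ : ∀ i < n, Measurable[𝓕 (τ i).toNNReal] (ξ i)) (hξ2 : ∀ i < n, MemLp (ξ i) 2 P)
    (hφ : ∀ i, Measurable (φ i))
    (hφ2 : ∀ i < n, MemLp (φ i) 2 (gaussianReal 0 (τ (i + 1) - τ i).toNNReal))
    (hφ0 : ∀ i < n, ∫ x, φ i x ∂(gaussianReal 0 (τ (i + 1) - τ i).toNNReal) = 0) :
    MemLp (fun ω => ∑ i ∈ Finset.range n, ξ i ω * φ i (incr B (τ i) (τ (i + 1)) ω)) 2 P ∧
      ∫ ω, (∑ i ∈ Finset.range n, ξ i ω * φ i (incr B (τ i) (τ (i + 1)) ω)) ^ 2 ∂P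
        = ∑ i ∈ Finset.range n, (∫ ω, ξ i ω ^ 2 ∂P)
          * ∫ x, φ i x ^ 2 ∂(gaussianReal 0 (τ (i + 1) - τ i).toNNReal) := by
  have h0 : ∀ i, 0 ≤ τ i := fun i => hτ0.trans (hτ (Nat.zero_le i))
  have hle : ∀ i, τ i ≤ τ (i + 1) := fun i => hτ (Nat.le_succ i)
  obtain ⟨h1, h2⟩ := memLp_and_integral_sq_sum_mul (P := P) (fun i => 𝓕 (τ i).toNNReal)
    (fun i j hij => 𝓕.mono (Real.toNNReal_le_toNNReal (hτ hij))) ξ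
    (fun i ω => φ i (incr B (τ i) (τ (i + 1)) ω)) n hξ hξ2
    (fun i _ => (hφ i).comp (hB.measurable_incr (hle i)))
    (fun i hi => hB.memLp_comp_incr (h0 i) (hle i) (hφ2 i hi))
    (fun i _ => hB.indep_comp_incr (hle i) (hφ i))
    (fun i hi => by rw [hB.integral_comp_incr (h0 i) (hle i) (hφ i), hφ0 i hi])
  refine ⟨h1, h2.trans (Finset.sum_congr rfl fun i _ => ?_)⟩
  rw [hB.integral_comp_incr (h0 i) (hle i) (φ := fun x => φ i x ^ 2) ((hφ i).pow_const 2)]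

end Brownian

/-! ### Almost sure convergence along subsequences. -/

section Convergence

variable {P : Measure Ω}

/-- For nonnegative F this is convergence in L¹, hence in measure, hence almost surely along a
subsequence. -/
theorem exists_seq_tendsto_ae_of_tendsto_integral {F : ℕ → Ω → ℝ}
    (hF : ∀ k, Integrable (F k) P) (hF0 : ∀ k, 0 ≤ F k)
    (h : Tendsto (fun k => ∫ ω, F k ω ∂P) atTop (nhds 0)) :
    ∃ ns : ℕ → ℕ, StrictMono ns ∧ ∀ᵐ ω ∂P, Tendsto (fun k => F (ns k) ω) atTop (nhds 0) := by
  have hm : TendstoInMeasure P F atTop (fun _ => (0 : ℝ)) := by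
    refine tendstoInMeasure_of_tendsto_eLpNorm (p := 1) one_ne_zero
      (fun k => (hF k).aestronglyMeasurable) aestronglyMeasurable_const ?_
    have h' := ENNReal.tendsto_ofReal h
    rw [ENNReal.ofReal_zero] at h'
    refine h'.congr fun k => ?_
    rw [show F k - (fun _ => (0 : ℝ)) = F k from sub_zero (F k), eLpNorm_one_eq_lintegral_enorm,
      ← ofReal_integral_norm_eq_lintegral_enorm (hF k)]
    congr 1
    refine integral_congr_ae (ae_of_all _ fun ω => ?_)
    simp [abs_of_nonneg (hF0 k ω)]
  exact hm.exists_seq_tendsto_ae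

theorem exists_seq_tendsto_ae_of_tendsto_integral_sq {X : ℕ → Ω → ℝ}
    (hX : ∀ k, MemLp (X k) 2 P)
    (h : Tendsto (fun k => ∫ ω, X k ω ^ 2 ∂P) atTop (nhds 0)) :
    ∃ ns : ℕ → ℕ, StrictMono ns ∧ ∀ᵐ ω ∂P, Tendsto (fun k => X (ns k) ω) atTop (nhds 0) := by
  obtain ⟨ns, hns, hae⟩ := exists_seq_tendsto_ae_of_tendsto_integral
    (F := fun k ω => X k ω ^ 2) (fun k => (hX k).integrable_sq) (fun k ω => sq_nonneg _) h
  refine ⟨ns, hns, hae.mono fun ω hω => ?_⟩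
  have h1 := hω.sqrt
  simp only [Real.sqrt_sq_eq_abs, Real.sqrt_zero] at h1
  exact (tendsto_zero_iff_abs_tendsto_zero _).2 h1

/-- The sum of squared steps is the difference between the right- and left-endpoint Riemann sums of
∫ u du. -/
theorem IsPartitionSeq.tendsto_sum_sq {a b : ℝ} {n : ℕ → ℕ} {τ : ℕ → ℕ → ℝ}
    (hτ : IsPartitionSeq a b n τ) :
    Tendsto (fun k => ∑ i ∈ Finset.range (n k), (τ k (i + 1) - τ k i) ^ 2) atTop (nhds 0) := by
  have h := (hτ.tendsto_sum_mul_integral (f := id) (h := fun _ => 1) continuousOn_id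
    intervalIntegrable_const (θ := fun k i => τ k (i + 1))
    fun k i _ => Set.right_mem_Icc.2 (hτ.mono k (Nat.le_succ i))).sub
    (hτ.tendsto_sum_mul_integral (f := id) (h := fun _ => 1) continuousOn_id
    intervalIntegrable_const (θ := τ)
    fun k i _ => Set.left_mem_Icc.2 (hτ.mono k (Nat.le_succ i)))
  rw [sub_self] at h
  refine h.congr fun k => ?_
  rw [← Finset.sum_sub_distrib]
  refine Finset.sum_congr rfl fun i _ => ?_
  simp
  ring

end Convergence

/-! ### Existence of the reputation for deterministic controls. -/

section Existence

variable {P : Measure Ω} {𝓕 : Filtration ℝ≥0 mΩ} {B : ℝ≥0 → Ω → ℝ}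

/-- The left-endpoint sums of `H = a M` converge if `M dB` has a continuous primitive `W` in the
sense of `herr` and `a` is a primitive of the deterministic function `h`. -/
theorem isItoIntegral_of_primitive [IsFiniteMeasure P] (hB : IsBrownianMotion P 𝓕 B) {t s : ℝ}
    {H W : ℝ → Ω → ℝ} {a h : ℝ → ℝ} (hH : ∀ u ∈ Set.Icc t s, Measurable (H u))
    (hh : IntervalIntegrable h volume t s)
    (ha : ∀ u ∈ Set.Icc t s, ∀ v ∈ Set.Icc t s, a v - a u = ∫ x in u..v, h x)
    (hW : ∀ᵐ ω ∂P, ContinuousOn (fun u => W u ω) (Set.Icc t s))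
    (herr : ∀ n τ, IsPartitionSeq t s n τ → ∃ ns : ℕ → ℕ, StrictMono ns ∧ ∀ᵐ ω ∂P,
      Tendsto (fun k => ∑ i ∈ Finset.range (n (ns k)), a (τ (ns k) i)
        * (W (τ (ns k) (i + 1)) ω - W (τ (ns k) i) ω) - leftSum B H (n (ns k)) (τ (ns k)) ω)
        atTop (nhds 0)) :
    IsItoIntegral P B H t s
      (fun ω => a s * W s ω - a t * W t ω - ∫ u in t..s, W u ω * h u) := by
  intro n τ h1 h2 h3 h4
  have hτ : IsPartitionSeq t s n τ := ⟨h1, h2, h3, h4⟩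
  have hmeas : ∀ k, AEStronglyMeasurable (leftSum B H (n k) (τ k)) P := fun k => by
    refine Measurable.aestronglyMeasurable ?_
    unfold leftSum
    refine Finset.measurable_fun_sum _ fun i hi => ?_
    exact (hH _ (hτ.mem_Icc (Finset.mem_range.1 hi).le)).mul (hB.measurable_incr' _ _)
  -- Convergence in measure holds if every subsequence has an almost surely convergent further
  -- subsequence. From here on the argument is pathwise.
  rw [exists_seq_tendstoInMeasure_atTop_iff hmeas]
  intro ns hns
  obtain ⟨ns', hns', hae⟩ := herr _ _ (hτ.comp hns)
  refine ⟨ns', hns', ?_⟩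
  have hτ' := (hτ.comp hns).comp hns'
  filter_upwards [hae, hW] with ω hω hWω
  have hlim := hτ'.tendsto_sum_mul_integral hWω hh
    (θ := fun k i => (τ ∘ ns ∘ ns') k (i + 1))
    (fun k i _ => Set.right_mem_Icc.2 (hτ'.mono k (Nat.le_succ i)))
  -- Summation by parts: with a at left endpoints, W must appear at right endpoints. The remaining
  -- sum is an ordinary Riemann-Stieltjes sum against h(u) du.
  have habel : ∀ k, ∑ i ∈ Finset.range (n (ns (ns' k))), a (τ (ns (ns' k)) i)
        * (W (τ (ns (ns' k)) (i + 1)) ω - W (τ (ns (ns' k)) i) ω)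
      = a s * W s ω - a t * W t ω - ∑ i ∈ Finset.range (n (ns (ns' k))),
        W (τ (ns (ns' k)) (i + 1)) ω * ∫ x in τ (ns (ns' k)) i..τ (ns (ns' k)) (i + 1), h x := by
    intro k
    rw [← hτ.sum_sub (fun u => a u * W u ω) (ns (ns' k)), ← Finset.sum_sub_distrib]
    refine Finset.sum_congr rfl fun i hi => ?_
    have hi' := Finset.mem_range.1 hi
    rw [← ha _ (hτ.mem_Icc hi'.le) _ (hτ.mem_Icc hi')]
    ring
  have hfin := (hlim.const_sub (a s * W s ω - a t * W t ω)).sub hω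
  rw [sub_zero] at hfin
  refine hfin.congr fun k => ?_
  have h5 := habel k
  simp only [Function.comp_apply] at h5 ⊢
  rw [h5]
  ring

/-- The exponential martingale `exp (σ (B_s - B_t) - σ² (s - t) / 2)`. -/
noncomputable def expMart (B : ℝ≥0 → Ω → ℝ) (σ t s : ℝ) (ω : Ω) : ℝ :=
  Real.exp (σ * incr B t s ω - σ ^ 2 * (s - t) / 2)

variable {σ t s : ℝ}

theorem expMart_self (ω : Ω) : expMart B σ t t ω = 1 := by simp [expMart]

theorem expMart_pos (ω : Ω) : 0 < expMart B σ t s ω := Real.exp_pos _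

theorem expMart_zero (ω : Ω) : expMart B 0 t s ω = 1 := by simp [expMart]

theorem expMart_mul (u : ℝ) (ω : Ω) :
    expMart B σ t u ω = expMart B σ t s ω * expMart B σ s u ω := by
  simp only [expMart, incr]
  rw [← Real.exp_add]
  congr 1
  ring

theorem IsBrownianMotion.measurable_expMart (hB : IsBrownianMotion P 𝓕 B) (hts : t ≤ s) :
    Measurable[𝓕 s.toNNReal] (expMart B σ t s) :=
  Real.measurable_exp.comp (((hB.measurable_incr hts).const_mul σ).sub_const _)

theorem IsBrownianMotion.ae_continuous_expMart (hB : IsBrownianMotion P 𝓕 B) (σ t : ℝ) :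
    ∀ᵐ ω ∂P, Continuous fun s => expMart B σ t s ω := by
  filter_upwards [hB.isBrownianReal.cont] with ω hω
  have : Continuous fun s : ℝ => B s.toNNReal ω := hω.comp continuous_real_toNNReal
  unfold expMart incr
  fun_prop

theorem IsBrownianMotion.memLp_expMart (hB : IsBrownianMotion P 𝓕 B) [IsFiniteMeasure P]
    (ht : 0 ≤ t) (hts : t ≤ s) : MemLp (expMart B σ t s) 2 P := by
  have h := (hB.memLp_comp_incr ht hts (memLp_exp_mul_gaussianReal _ σ)).const_mul
    (Real.exp (-(σ ^ 2 * (s - t) / 2)))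
  refine h.congr_norm ((hB.measurable_expMart hts).mono (𝓕.le _) le_rfl).aestronglyMeasurable
    (ae_of_all _ fun ω => ?_)
  rw [← Real.exp_add, expMart]
  congr 2
  ring

theorem IsBrownianMotion.integral_expMart (hB : IsBrownianMotion P 𝓕 B)
    (ht : 0 ≤ t) (hts : t ≤ s) : ∫ ω, expMart B σ t s ω ∂P = 1 := by
  have h := hB.integral_comp_incr ht hts (φ := fun x => Real.exp (-(σ ^ 2 * (s - t) / 2))
    * Real.exp (σ * x)) (by fun_prop)
  rw [integral_const_mul, integral_const_mul, integral_exp_mul_gaussianReal,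
    Real.coe_toNNReal _ (sub_nonneg.2 hts), ← Real.exp_add] at h
  rw [show -(σ ^ 2 * (s - t) / 2) + (s - t) * σ ^ 2 / 2 = 0 by ring, Real.exp_zero] at h
  rw [← h, ← integral_const_mul]
  refine integral_congr_ae (ae_of_all _ fun ω => ?_)
  simp only [expMart]
  rw [← Real.exp_add]
  congr 1
  ring

/-- The square of the martingale with exponent σ is a deterministic factor times the one with
exponent 2σ, whose mean is 1. -/
theorem IsBrownianMotion.integral_expMart_sq (hB : IsBrownianMotion P 𝓕 B)
    (ht : 0 ≤ t) (hts : t ≤ s) :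
    ∫ ω, expMart B σ t s ω ^ 2 ∂P = Real.exp (σ ^ 2 * (s - t)) := by
  have h : ∀ ω, expMart B σ t s ω ^ 2
      = Real.exp (σ ^ 2 * (s - t)) * expMart B (2 * σ) t s ω := fun ω => by
    rw [expMart, expMart, ← Real.exp_nat_mul, ← Real.exp_add]
    congr 1
    push_cast
    ring
  simp only [h]
  rw [integral_const_mul, hB.integral_expMart ht hts, mul_one]

/-- `M = expMart` satisfies `dM = σ M dB`, in the form needed for `isItoIntegral_of_primitive`. -/
theorem IsBrownianMotion.exists_seq_sum_expMart [IsProbabilityMeasure P]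
    (hB : IsBrownianMotion P 𝓕 B) (ht : 0 ≤ t) (hσ : σ ≠ 0) {a : ℝ → ℝ} {K : ℝ}
    (hK : ∀ u ∈ Set.Icc t s, |a u| ≤ K) {n : ℕ → ℕ} {τ : ℕ → ℕ → ℝ}
    (hτ : IsPartitionSeq t s n τ) :
    ∃ ns : ℕ → ℕ, StrictMono ns ∧ ∀ᵐ ω ∂P,
      Tendsto (fun k => ∑ i ∈ Finset.range (n (ns k)), a (τ (ns k) i)
        * (expMart B σ t (τ (ns k) (i + 1)) ω / σ - expMart B σ t (τ (ns k) i) ω / σ)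
        - leftSum B (fun u ω => a u * expMart B σ t u ω) (n (ns k)) (τ (ns k)) ω)
        atTop (nhds 0) := by
  -- By multiplicativity, the increment of M divided by σ equals M at the left endpoint times (ΔB +
  -- `expError`). So X is exactly the discrepancy to be made small, with adapted weights a M and
  -- centered factors.
  set X : ℕ → Ω → ℝ := fun k ω => ∑ i ∈ Finset.range (n k),
    (a (τ k i) * expMart B σ t (τ k i) ω)
      * expError σ (τ k (i + 1) - τ k i).toNNReal (incr B (τ k i) (τ k (i + 1)) ω) with hX
  have hle : ∀ k i, τ k i ≤ τ k (i + 1) := fun k i => hτ.mono k (Nat.le_succ i)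
  have htτ : ∀ k i, t ≤ τ k i := fun k i =>
    (hτ.left k).symm.le.trans (hτ.mono k (Nat.zero_le i))
  have hXeq : ∀ k ω, X k ω = ∑ i ∈ Finset.range (n k), a (τ k i)
        * (expMart B σ t (τ k (i + 1)) ω / σ - expMart B σ t (τ k i) ω / σ)
        - leftSum B (fun u ω => a u * expMart B σ t u ω) (n k) (τ k) ω := by
    intro k ω
    rw [leftSum, ← Finset.sum_sub_distrib]
    refine Finset.sum_congr rfl fun i _ => ?_
    rw [expMart_mul (s := τ k i) (τ k (i + 1)), expError,
      Real.coe_toNNReal _ (sub_nonneg.2 (hle k i))]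
    simp only [expMart]
    ring
  have hξ2 : ∀ k, ∀ i < n k, MemLp (fun ω => a (τ k i) * expMart B σ t (τ k i) ω) 2 P :=
    fun k i _ => (hB.memLp_expMart ht (htτ k i)).const_mul _
  have hmain := fun k => hB.memLp_and_integral_sq_sum (hτ.mono k) (by rw [hτ.left]; exact ht) (n k)
    (fun i ω => a (τ k i) * expMart B σ t (τ k i) ω)
    (fun i => expError σ (τ k (i + 1) - τ k i).toNNReal)
    (fun i _ => (hB.measurable_expMart (htτ k i)).const_mul _) (hξ2 k)
    (fun i => (continuous_expError _ _).measurable)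
    (fun i _ => memLp_expError σ _) (fun i _ => integral_expError _)
  have hlim : Tendsto (fun k => ∫ ω, X k ω ^ 2 ∂P) atTop (nhds 0) := by
    have hz := hτ.tendsto_sum_sq.const_mul (K ^ 2 * Real.exp (σ ^ 2 * (s - t)) * σ ^ 2)
    rw [mul_zero] at hz
    refine squeeze_zero' (Eventually.of_forall fun k => integral_nonneg fun ω => sq_nonneg _) ?_ hz
    have hσ2 : 0 < σ ^ 2 := by positivity
    -- Once the mesh is below 1/σ², the bound |e^x - 1 - x| ≤ x², valid for |x| ≤ 1, applies to x =
    -- σ² times each step.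
    filter_upwards [hτ.mesh (1 / σ ^ 2) (by positivity)] with k hk
    rw [(hmain k).2, Finset.mul_sum]
    refine Finset.sum_le_sum fun i hi => ?_
    have hi' := Finset.mem_range.1 hi
    have hI := hτ.mem_Icc (k := k) hi'.le
    have hΔ : 0 ≤ τ k (i + 1) - τ k i := sub_nonneg.2 (hle k i)
    simp only [mul_pow]
    rw [integral_const_mul, hB.integral_expMart_sq ht (htτ k i), integral_expError_sq hσ,
      Real.coe_toNNReal _ hΔ, mul_assoc]
    have h1 : a (τ k i) ^ 2 * Real.exp (σ ^ 2 * (τ k i - t))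
        ≤ K ^ 2 * Real.exp (σ ^ 2 * (s - t)) := by
      rw [← sq_abs (a (τ k i))]
      gcongr
      · exact hK _ hI
      · exact hI.2
    have hx : |σ ^ 2 * (τ k (i + 1) - τ k i)| ≤ 1 := by
      rw [abs_of_nonneg (by positivity)]
      have := hk i hi'
      rw [lt_div_iff₀ hσ2] at this
      linarith
    have h2 : (Real.exp (σ ^ 2 * (τ k (i + 1) - τ k i)) - 1 - σ ^ 2 * (τ k (i + 1) - τ k i))
        / σ ^ 2 ≤ σ ^ 2 * (τ k (i + 1) - τ k i) ^ 2 := by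
      rw [div_le_iff₀ hσ2]
      refine (le_abs_self _).trans ((Real.abs_exp_sub_one_sub_id_le hx).trans_eq ?_)
      ring
    have h3 : 0 ≤ (Real.exp (σ ^ 2 * (τ k (i + 1) - τ k i)) - 1
        - σ ^ 2 * (τ k (i + 1) - τ k i)) / σ ^ 2 := by
      have := Real.add_one_le_exp (σ ^ 2 * (τ k (i + 1) - τ k i))
      apply div_nonneg _ hσ2.le
      linarith
    rw [← mul_assoc]
    refine (mul_le_mul h1 h2 h3 (by positivity)).trans_eq ?_
    ring
  obtain ⟨ns, hns, hae⟩ := exists_seq_tendsto_ae_of_tendsto_integral_sq (fun k => (hmain k).1) hlim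
  refine ⟨ns, hns, hae.mono fun ω hω => hω.congr fun k => hXeq (ns k) ω⟩

/-- The solution `r exp (∫_t^s m) exp (σ (B_s - B_t) - σ² (s - t) / 2)` of the state equation. -/
noncomputable def solution (B : ℝ≥0 → Ω → ℝ) (σ r t : ℝ) (m : ℝ → ℝ) (s : ℝ) (ω : Ω) : ℝ :=
  r * Real.exp (∫ u in t..s, m u) * expMart B σ t s ω

/-- Existence for deterministic bounded controls. -/
theorem IsBrownianMotion.isReputation_solution [IsProbabilityMeasure P]
    (hB : IsBrownianMotion P 𝓕 B) {T r C : ℝ} (ht : 0 ≤ t) (hr : 0 < r) {m : ℝ → ℝ}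
    (hm : Measurable m) (hC : ∀ s, |m s| ≤ C) :
    IsReputation P 𝓕 B σ T t r (fun s _ => m s) (solution B σ r t m) := by
  have hcm : Continuous fun s => ∫ u in t..s, m u := (lipschitzWith_integral hm hC t).continuous
  set a : ℝ → ℝ := fun s => r * Real.exp (∫ u in t..s, m u) with ha
  have hac : Continuous a := by fun_prop
  have hat : a t = r := by simp [ha]
  have hint : ∀ x y, IntervalIntegrable (fun u => a u * m u) volume x y := fun x y =>
    (intervalIntegrable_of_bound hm hC x y).continuousOn_mul hac.continuousOn
  have hprim : ∀ v, t ≤ v → a v - a t = ∫ x in t..v, a x * m x := fun v hv => by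
    have h := integral_deriv_add_mul_mul_exp_integral (g := fun _ => r) (g' := fun _ => 0) hv
      (fun s _ => hasDerivWithinAt_const _ _ _) continuousOn_const hm hC
    rw [hat, ← h]
    refine intervalIntegral.integral_congr fun x _ => ?_
    simp only [ha]
    ring
  have hprim' : ∀ s, ∀ u ∈ Set.Icc t s, ∀ v ∈ Set.Icc t s,
      a v - a u = ∫ x in u..v, a x * m x := fun s u hu v hv => by
    rw [← intervalIntegral.integral_interval_sub_left (hint t v) (hint t u),
      ← hprim v hv.1, ← hprim u hu.1]
    ring
  have hmeas : ∀ s, t ≤ s → Measurable[𝓕 s.toNNReal] (solution B σ r t m s) := fun s hs =>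
    (hB.measurable_expMart hs).const_mul _
  refine ⟨fun s hs => hmeas s hs.1, ?_, ?_, ?_, ?_⟩
  · filter_upwards [hB.ae_continuous_expMart σ t] with ω hω
    exact (hac.mul hω).continuousOn
  · exact ae_of_all _ fun ω s _ => mul_pos (by positivity) (expMart_pos ω)
  · refine ae_of_all _ fun ω => ?_
    rw [solution, expMart_self, mul_one]
    exact hat
  -- If σ = 0, dividing by σ is meaningless, but then M = 1 and the Brownian motion itself serves as
  -- W. Otherwise W = M/σ. Even for σ = 0 the definition asks for an Itô integral of R.
  · by_cases hσ : σ = 0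
    · subst hσ
      refine ⟨_, fun s hs => ⟨isItoIntegral_of_primitive hB
        (fun u hu => (hmeas u hu.1).mono (𝓕.le _) le_rfl) (hint t s) (hprim' s)
        (W := fun u ω => B u.toNNReal ω) ?_ ?_, ?_⟩⟩
      · filter_upwards [hB.isBrownianReal.cont] with ω hω
        exact (hω.comp continuous_real_toNNReal).continuousOn
      · refine fun n τ _ => ⟨id, strictMono_id, ae_of_all _ fun ω => ?_⟩
        refine tendsto_const_nhds.congr fun k => ?_
        rw [leftSum, ← Finset.sum_sub_distrib]
        refine (Finset.sum_eq_zero fun i _ => ?_).symm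
        simp only [solution, expMart_zero, mul_one, sub_self, ha, id]
      · refine ae_of_all _ fun ω => ?_
        simp only [solution, expMart_zero, mul_one, zero_mul, add_zero]
        rw [← hprim s hs.1, hat]
        ring
    · refine ⟨_, fun s hs => ⟨isItoIntegral_of_primitive hB
        (fun u hu => (hmeas u hu.1).mono (𝓕.le _) le_rfl) (hint t s) (hprim' s)
        (W := fun u ω => expMart B σ t u ω / σ) ?_ ?_, ?_⟩⟩
      · filter_upwards [hB.ae_continuous_expMart σ t] with ω hω
        exact (hω.div_const σ).continuousOn
      · obtain ⟨K, hK⟩ := isCompact_Icc.exists_bound_of_continuousOn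
          (hac.continuousOn (s := Set.Icc t s))
        exact fun n τ hτ => hB.exists_seq_sum_expMart ht hσ hK hτ
      · refine ae_of_all _ fun ω => ?_
        simp only [expMart_self, hat, solution]
        have h1 : ∫ u in t..s, expMart B σ t u ω / σ * (a u * m u)
            = (∫ u in t..s, r * Real.exp (∫ x in t..u, m x) * expMart B σ t u ω * m u) / σ := by
          rw [← intervalIntegral.integral_div]
          refine intervalIntegral.integral_congr fun u _ => ?_
          simp only [ha]
          ring
        rw [h1]
        simp only [ha]
        field_simp
        ring

end Existence

/-! ### Uniform grids and their refinements. -/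

section UniformPartition

/-- The `i`-th point `a + i (b - a) / n` of the uniform partition of `[a, b]`. -/
noncomputable def gridPoint (a b : ℝ) (n i : ℕ) : ℝ := a + i * ((b - a) / n)

variable {a b : ℝ}

theorem gridPoint_zero (n : ℕ) : gridPoint a b n 0 = a := by simp [gridPoint]

theorem gridPoint_self {n : ℕ} (hn : n ≠ 0) : gridPoint a b n n = b := by
  have : (n : ℝ) ≠ 0 := by exact_mod_cast hn
  rw [gridPoint]
  field_simp
  ring

theorem gridPoint_succ_sub (n i : ℕ) :
    gridPoint a b n (i + 1) - gridPoint a b n i = (b - a) / n := by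
  simp only [gridPoint]
  push_cast
  ring

theorem monotone_gridPoint (hab : a ≤ b) (n : ℕ) : Monotone (gridPoint a b n) := by
  refine monotone_nat_of_le_succ fun i => ?_
  have h := gridPoint_succ_sub (a := a) (b := b) n i
  have : 0 ≤ (b - a) / n := div_nonneg (sub_nonneg.2 hab) (Nat.cast_nonneg n)
  linarith

theorem gridPoint_mul (n : ℕ) {m : ℕ} (hm : m ≠ 0) (i : ℕ) :
    gridPoint a b (n * m) (i * m) = gridPoint a b n i := by
  have : (m : ℝ) ≠ 0 := by exact_mod_cast hm
  simp only [gridPoint]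
  push_cast
  by_cases hn : (n : ℝ) = 0
  · simp [hn]
  · field_simp

theorem gridPoint_mem (hab : a ≤ b) {n i : ℕ} (hn : n ≠ 0) (hi : i ≤ n) :
    gridPoint a b n i ∈ Set.Icc a b :=
  ⟨(gridPoint_zero n).symm.le.trans (monotone_gridPoint hab n (Nat.zero_le i)),
    (monotone_gridPoint hab n hi).trans (gridPoint_self hn).le⟩

theorem tendsto_div_add_one (c : ℝ) :
    Tendsto (fun k : ℕ => c / ((k + 1 : ℕ) : ℝ)) atTop (nhds 0) :=
  (tendsto_const_div_atTop_nhds_zero_nat c).comp (tendsto_add_atTop_nat 1)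

theorem isPartitionSeq_gridPoint (hab : a ≤ b) :
    IsPartitionSeq a b (fun k => k + 1) (fun k => gridPoint a b (k + 1)) :=
  ⟨fun k => monotone_gridPoint hab _, fun k => gridPoint_zero _,
    fun k => gridPoint_self (Nat.succ_ne_zero k), fun δ hδ => by
      filter_upwards [(tendsto_div_add_one (b - a)).eventually (gt_mem_nhds hδ)] with k hk i _
      rw [gridPoint_succ_sub]
      exact hk⟩

/-- The i-th point of the coarse grid has index i(m + 1) in the refined one. Initial segments of one
refined grid thus partition all the intervals from a to a coarse grid point simultaneously. -/
theorem isPartitionSeq_gridPoint_mul (hab : a ≤ b) (n i : ℕ) :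
    IsPartitionSeq a (gridPoint a b n i) (fun m => i * (m + 1))
      (fun m => gridPoint a b (n * (m + 1))) :=
  ⟨fun k => monotone_gridPoint hab _, fun k => gridPoint_zero _,
    fun k => gridPoint_mul n (Nat.succ_ne_zero k) i, fun δ hδ => by
      filter_upwards [(tendsto_div_add_one ((b - a) / n)).eventually (gt_mem_nhds hδ)] with m hm j _
      rw [gridPoint_succ_sub, Nat.cast_mul, ← div_div]
      exact hm⟩

theorem sum_range_mul_eq (f : ℕ → ℝ) (q M : ℕ) :
    ∑ j ∈ Finset.range (q * M), f j
      = ∑ i ∈ Finset.range q, ∑ l ∈ Finset.range M, f (i * M + l) := by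
  induction q with
  | zero => simp
  | succ q ih => rw [Nat.succ_mul, Finset.sum_range_add, ih, Finset.sum_range_succ]

end UniformPartition

/-! ### Replacing Itô integrals by left sums, and L² bounds for the block errors. -/

section Approximation

variable {P : Measure Ω} {𝓕 : Filtration ℝ≥0 mΩ} {B : ℝ≥0 → Ω → ℝ}

/-- Left-endpoint sums along sufficiently fine refinements of the uniform grids approximate the Itô
integral at all the grid points simultaneously. -/
theorem exists_refinement {t s : ℝ} (hts : t ≤ s) {R I : ℝ → Ω → ℝ}
    (hI : ∀ u ∈ Set.Icc t s, IsItoIntegral P B R t u (I u)) :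
    ∃ m : ℕ → ℕ, ∀ᵐ ω ∂P, ∀ᶠ k in atTop, ∀ i ≤ k + 1,
      |leftSum B R (i * (m k + 1)) (gridPoint t s ((k + 1) * (m k + 1))) ω
        - I (gridPoint t s (k + 1) i) ω| ≤ 1 / ((k + 1 : ℕ) : ℝ) ^ 2 := by
  set Bad : ℕ → ℕ → ℕ → Set Ω := fun k m i =>
    {ω | ENNReal.ofReal (1 / ((k + 1 : ℕ) : ℝ) ^ 2) ≤
      edist (leftSum B R (i * (m + 1)) (gridPoint t s ((k + 1) * (m + 1))) ω)
        (I (gridPoint t s (k + 1) i) ω)} with hBad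
  -- For fixed k only k + 2 integrals are involved, so a fine enough refinement makes the total
  -- failure probability at most 2^{-k}, and Borel-Cantelli applies. The tolerance 1/(k + 1)² is
  -- small enough to be summed over k + 1 blocks.
  have hchoose : ∀ k : ℕ, ∃ m : ℕ,
      ∑ i ∈ Finset.range (k + 2), P (Bad k m i) ≤ (2⁻¹ : ENNReal) ^ k := by
    intro k
    have hlim : Tendsto (fun m => ∑ i ∈ Finset.range (k + 2), P (Bad k m i)) atTop (nhds 0) := by
      rw [← Finset.sum_const_zero (s := Finset.range (k + 2))]
      refine tendsto_finsetSum _ fun i hi => ?_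
      have hp := isPartitionSeq_gridPoint_mul hts (k + 1) i
      exact hI _ (gridPoint_mem hts (Nat.succ_ne_zero k)
        (Nat.lt_succ_iff.1 (Finset.mem_range.1 hi))) _ _ hp.mono hp.left hp.right hp.mesh
        (ENNReal.ofReal (1 / ((k + 1 : ℕ) : ℝ) ^ 2)) (by
          rw [ENNReal.ofReal_pos]; positivity)
    have hpos : (0 : ENNReal) < 2⁻¹ ^ k := ENNReal.pow_pos (by simp) _
    obtain ⟨m, hm⟩ := (hlim.eventually (gt_mem_nhds hpos)).exists
    exact ⟨m, hm.le⟩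
  choose m hm using hchoose
  refine ⟨m, ?_⟩
  have hsum : ∑' k, P (⋃ i ∈ Finset.range (k + 2), Bad k (m k) i) ≠ ⊤ := by
    refine ne_top_of_le_ne_top ?_ (ENNReal.tsum_le_tsum fun k =>
      (measure_biUnion_finset_le _ _).trans (hm k))
    simp only [ENNReal.tsum_geometric, ENNReal.one_sub_inv_two, inv_inv]
    exact ENNReal.ofNat_ne_top
  filter_upwards [ae_eventually_notMem hsum] with ω hω
  filter_upwards [hω] with k hk i hi
  simp only [Set.mem_iUnion, not_exists] at hk
  have h := hk i (Finset.mem_range.2 (by omega))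
  simp only [hBad, Set.mem_ofPred_eq, not_le] at h
  rw [edist_dist, ENNReal.ofReal_lt_ofReal_iff (by positivity), Real.dist_eq] at h
  exact h.le

/-- The difference between the left-endpoint sum of `H dB` over the `i`-th block of `M` steps and
its one-step approximation. -/
noncomputable def blockError (B : ℝ≥0 → Ω → ℝ) (H : ℝ → Ω → ℝ) (τ : ℕ → ℝ) (M i : ℕ) (ω : Ω) : ℝ :=
  ∑ l ∈ Finset.range M, (H (τ (i * M + l)) ω - H (τ (i * M)) ω)
    * incr B (τ (i * M + l)) (τ (i * M + l + 1)) ω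

theorem blockError_eq (H : ℝ → Ω → ℝ) (τ : ℕ → ℝ) (M i : ℕ) (ω : Ω) :
    blockError B H τ M i ω = leftSum B H ((i + 1) * M) τ ω - leftSum B H (i * M) τ ω
      - H (τ (i * M)) ω * incr B (τ (i * M)) (τ ((i + 1) * M)) ω := by
  have h1 : incr B (τ (i * M)) (τ ((i + 1) * M)) ω
      = ∑ l ∈ Finset.range M, incr B (τ (i * M + l)) (τ (i * M + l + 1)) ω := by
    have := Finset.sum_range_sub (fun l => B (τ (i * M + l)).toNNReal ω) M
    rw [Nat.succ_mul]
    exact this.symm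
  rw [h1, leftSum, leftSum, Nat.succ_mul, Finset.sum_range_add, add_sub_cancel_left, Finset.mul_sum,
    ← Finset.sum_sub_distrib]
  refine Finset.sum_congr rfl fun l _ => ?_
  ring_nf

/-- The mean square oscillation of `H` within blocks of `M` steps. -/
noncomputable def blockOsc (H : ℝ → Ω → ℝ) (τ : ℕ → ℝ) (q M : ℕ) (ω : Ω) : ℝ :=
  ∑ i ∈ Finset.range q, ∑ l ∈ Finset.range M, (H (τ (i * M + l)) ω - H (τ (i * M)) ω) ^ 2
    * (τ (i * M + l + 1) - τ (i * M + l))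

variable [IsProbabilityMeasure P]

/-- L² bounds for the block errors of a bounded adapted integrand. -/
theorem IsBrownianMotion.integral_blockError_le (hB : IsBrownianMotion P 𝓕 B) {H : ℝ → Ω → ℝ}
    {τ : ℕ → ℝ} (hτ : Monotone τ) (hτ0 : 0 ≤ τ 0) {q M : ℕ} (hM : 0 < M) {c K : ℝ} (hc : 0 < c)
    (hH : ∀ j < q * M, Measurable[𝓕 (τ j).toNNReal] (H (τ j)))
    (hcK : ∀ u ω, H u ω ∈ Set.Icc c K) :
    Integrable (fun ω => (∑ i ∈ Finset.range q, blockError B H τ M i ω / H (τ (i * M)) ω) ^ 2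
        + ∑ i ∈ Finset.range q, blockError B H τ M i ω ^ 2) P ∧
      ∫ ω, ((∑ i ∈ Finset.range q, blockError B H τ M i ω / H (τ (i * M)) ω) ^ 2
        + ∑ i ∈ Finset.range q, blockError B H τ M i ω ^ 2) ∂P
      ≤ (1 / c ^ 2 + 1) * ∫ ω, blockOsc H τ q M ω ∂P := by
  have hcK' : c ≤ K := by
    obtain ⟨ω⟩ : Nonempty Ω := nonempty_of_isProbabilityMeasure P
    exact (hcK 0 ω).1.trans (hcK 0 ω).2
  have hidx : ∀ i < q, ∀ l < M, i * M + l < q * M := fun i hi l hl => by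
    have : (i + 1) * M ≤ q * M := Nat.mul_le_mul_right M hi
    rw [Nat.succ_mul] at this
    omega
  have hidx0 : ∀ i < q, i * M < q * M := fun i hi => Nat.mul_lt_mul_of_pos_right hi hM
  have hdivlt : ∀ j < q * M, j / M * M < q * M := fun j hj =>
    (Nat.div_mul_le_self j M).trans_lt hj
  have hmono : ∀ {i j : ℕ}, i ≤ j → 𝓕 (τ i).toNNReal ≤ 𝓕 (τ j).toNNReal := fun h =>
    𝓕.mono (Real.toNNReal_le_toNNReal (hτ h))
  have hΔ : ∀ j, 0 ≤ τ (j + 1) - τ j := fun j => sub_nonneg.2 (hτ (Nat.le_succ j))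
  have hdiff : ∀ u v ω, |H u ω - H v ω| ≤ K := fun u v ω => by
    have h1 := hcK u ω
    have h2 := hcK v ω
    rw [abs_le]
    exact ⟨by linarith [h1.1, h2.2], by linarith [h1.2, h2.1]⟩
  have hdm : ∀ i < q, ∀ l < M, Measurable[𝓕 (τ (i * M + l)).toNNReal]
      (fun ω => H (τ (i * M + l)) ω - H (τ (i * M)) ω) := fun i hi l hl =>
    (hH _ (hidx i hi l hl)).sub ((hH _ (hidx0 i hi)).mono (hmono (Nat.le_add_right _ _)) le_rfl)
  have hd2 : ∀ i < q, ∀ l < M, MemLp (fun ω => H (τ (i * M + l)) ω - H (τ (i * M)) ω) 2 P :=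
    fun i hi l hl => MemLp.of_bound
      ((hdm i hi l hl).mono (𝓕.le _) le_rfl).aestronglyMeasurable K
      (ae_of_all _ fun ω => hdiff _ _ ω)
  have hgauss : ∀ v : ℝ≥0, MemLp (fun x : ℝ => x) 2 (gaussianReal 0 v) :=
    fun v => memLp_id_gaussianReal 2
  have hE := fun (i : ℕ) (hi : i < q) => hB.memLp_and_integral_sq_sum
    (τ := fun l => τ (i * M + l)) (fun l l' h => hτ (Nat.add_le_add_left h _))
    (hτ0.trans (hτ (Nat.zero_le _))) M (fun l ω => H (τ (i * M + l)) ω - H (τ (i * M)) ω)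
    (fun _ x => x) (hdm i hi) (hd2 i hi) (fun _ => measurable_id) (fun _ _ => hgauss _)
    (fun _ _ => integral_id_gaussianReal)
  -- With integer division, j / M * M is the first index of the block containing j. The normalised
  -- errors of all blocks become one sum with adapted weights, so orthogonality applies across
  -- blocks as well.
  set ξ : ℕ → Ω → ℝ := fun j ω =>
    (H (τ j) ω - H (τ (j / M * M)) ω) / H (τ (j / M * M)) ω with hξ
  have hξm : ∀ j < q * M, Measurable[𝓕 (τ j).toNNReal] (ξ j) := fun j hj => by
    have h1 := (hH _ (hdivlt j hj)).mono (hmono (Nat.div_mul_le_self j M)) le_rfl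
    exact ((hH j hj).sub h1).div h1
  have hξ2 : ∀ j < q * M, MemLp (ξ j) 2 P := fun j hj => by
    refine MemLp.of_bound ((hξm j hj).mono (𝓕.le _) le_rfl).aestronglyMeasurable (K / c)
      (ae_of_all _ fun ω => ?_)
    simp only [hξ, norm_div, Real.norm_eq_abs]
    have h1 := (hcK (τ (j / M * M)) ω).1
    rw [abs_of_pos (hc.trans_le h1)]
    exact div_le_div₀ (hc.le.trans hcK') (hdiff _ _ ω) hc h1
  obtain ⟨hU2, hU⟩ := hB.memLp_and_integral_sq_sum hτ hτ0 (q * M) ξ (fun _ x => x) hξm hξ2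
    (fun _ => measurable_id) (fun _ _ => hgauss _) (fun _ _ => integral_id_gaussianReal)
  have hUeq : ∀ ω, ∑ i ∈ Finset.range q, blockError B H τ M i ω / H (τ (i * M)) ω
      = ∑ j ∈ Finset.range (q * M), ξ j ω * incr B (τ j) (τ (j + 1)) ω := fun ω => by
    rw [sum_range_mul_eq]
    refine Finset.sum_congr rfl fun i _ => ?_
    rw [blockError, Finset.sum_div]
    refine Finset.sum_congr rfl fun l hl => ?_
    have hdiv : (i * M + l) / M = i := by
      rw [add_comm, Nat.add_mul_div_right _ _ hM, Nat.div_eq_of_lt (Finset.mem_range.1 hl),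
        zero_add]
    simp only [hξ, hdiv]
    ring
  have hosc_int : ∀ i < q, ∀ l < M, Integrable (fun ω =>
      (H (τ (i * M + l)) ω - H (τ (i * M)) ω) ^ 2 * (τ (i * M + l + 1) - τ (i * M + l))) P :=
    fun i hi l hl => (hd2 i hi l hl).integrable_sq.mul_const _
  have hosc : ∫ ω, blockOsc H τ q M ω ∂P = ∑ i ∈ Finset.range q, ∑ l ∈ Finset.range M,
      (∫ ω, (H (τ (i * M + l)) ω - H (τ (i * M)) ω) ^ 2 ∂P)
        * (τ (i * M + l + 1) - τ (i * M + l)) := by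
    unfold blockOsc
    rw [integral_finsetSum _ fun i hi => integrable_finsetSum _ fun l hl =>
      hosc_int i (Finset.mem_range.1 hi) l (Finset.mem_range.1 hl)]
    refine Finset.sum_congr rfl fun i hi => ?_
    rw [integral_finsetSum _ fun l hl =>
      hosc_int i (Finset.mem_range.1 hi) l (Finset.mem_range.1 hl)]
    exact Finset.sum_congr rfl fun l _ => integral_mul_const _ _
  have hV_int : ∀ i ∈ Finset.range q, Integrable (fun ω => blockError B H τ M i ω ^ 2) P :=
    fun i hi => (hE i (Finset.mem_range.1 hi)).1.integrable_sq
  have hV : ∫ ω, ∑ i ∈ Finset.range q, blockError B H τ M i ω ^ 2 ∂P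
      = ∫ ω, blockOsc H τ q M ω ∂P := by
    rw [integral_finsetSum _ hV_int, hosc]
    refine Finset.sum_congr rfl fun i hi => ?_
    refine (hE i (Finset.mem_range.1 hi)).2.trans (Finset.sum_congr rfl fun l _ => ?_)
    rw [integral_sq_gaussianReal, ← Nat.add_assoc, Real.coe_toNNReal _ (hΔ _)]
  have hUle : ∫ ω, (∑ i ∈ Finset.range q, blockError B H τ M i ω / H (τ (i * M)) ω) ^ 2 ∂P
      ≤ 1 / c ^ 2 * ∫ ω, blockOsc H τ q M ω ∂P := by
    simp only [hUeq]
    rw [hU, hosc, sum_range_mul_eq, Finset.mul_sum]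
    refine Finset.sum_le_sum fun i hi => ?_
    rw [Finset.mul_sum]
    refine Finset.sum_le_sum fun l hl => ?_
    have hdiv : (i * M + l) / M = i := by
      rw [add_comm, Nat.add_mul_div_right _ _ hM, Nat.div_eq_of_lt (Finset.mem_range.1 hl),
        zero_add]
    rw [integral_sq_gaussianReal, Real.coe_toNNReal _ (hΔ _), ← mul_assoc, ← integral_const_mul]
    refine mul_le_mul_of_nonneg_right ?_ (hΔ _)
    have hi' := Finset.mem_range.1 hi
    have hl' := Finset.mem_range.1 hl
    refine integral_mono (hξ2 _ (hidx i hi' l hl')).integrable_sq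
      ((hd2 i hi' l hl').integrable_sq.const_mul _) fun ω => ?_
    simp only [hξ, hdiv, div_pow]
    rw [div_eq_inv_mul, one_div]
    have h1 := (hcK (τ (i * M)) ω).1
    gcongr
  have hU_int : Integrable (fun ω =>
      (∑ i ∈ Finset.range q, blockError B H τ M i ω / H (τ (i * M)) ω) ^ 2) P := by
    simp only [hUeq]
    exact hU2.integrable_sq
  refine ⟨hU_int.add (integrable_finsetSum _ hV_int), ?_⟩
  rw [integral_add hU_int (integrable_finsetSum _ hV_int), hV, add_mul, one_mul]
  linarith

end Approximation

/-! ### Itô's formula for log R on the event that R stays in a compact interval. -/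

section Uniqueness

variable {P : Measure Ω} {𝓕 : Filtration ℝ≥0 mΩ} {B : ℝ≥0 → Ω → ℝ} {t s : ℝ}

theorem blockOsc_nonneg (H : ℝ → Ω → ℝ) {τ : ℕ → ℝ} (hτ : Monotone τ) (q M : ℕ) (ω : Ω) :
    0 ≤ blockOsc H τ q M ω :=
  Finset.sum_nonneg fun _ _ => Finset.sum_nonneg fun _ _ =>
    mul_nonneg (sq_nonneg _) (sub_nonneg.2 (hτ (Nat.le_succ _)))

/-- Each squared oscillation is at most η², and the step lengths add up to the total length. -/
theorem blockOsc_le {H : ℝ → Ω → ℝ} {τ : ℕ → ℝ} (hτ : Monotone τ) {q M : ℕ} {ω : Ω} {η : ℝ}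
    (h : ∀ i < q, ∀ l < M, |H (τ (i * M + l)) ω - H (τ (i * M)) ω| ≤ η) :
    blockOsc H τ q M ω ≤ η ^ 2 * (τ (q * M) - τ 0) := by
  rw [← Finset.sum_range_sub τ, sum_range_mul_eq, Finset.mul_sum]
  refine Finset.sum_le_sum fun i hi => ?_
  rw [Finset.mul_sum]
  refine Finset.sum_le_sum fun l hl => ?_
  refine mul_le_mul_of_nonneg_right ?_ (sub_nonneg.2 (hτ (Nat.le_succ _)))
  rw [← sq_abs]
  have := h i (Finset.mem_range.1 hi) l (Finset.mem_range.1 hl)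
  gcongr

theorem gridPoint_block_mem (hts : t ≤ s) (k m : ℕ) {i l : ℕ} (hl : l < m + 1) :
    gridPoint t s ((k + 1) * (m + 1)) (i * (m + 1) + l)
      ∈ Set.Icc (gridPoint t s (k + 1) i) (gridPoint t s (k + 1) (i + 1)) := by
  have hmono := monotone_gridPoint hts ((k + 1) * (m + 1))
  rw [← gridPoint_mul (m := m + 1) (k + 1) (Nat.succ_ne_zero m) i,
    ← gridPoint_mul (m := m + 1) (k + 1) (Nat.succ_ne_zero m) (i + 1)]
  refine ⟨hmono (Nat.le_add_right _ _), hmono ?_⟩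
  rw [Nat.succ_mul]
  omega

/-- The mean square oscillation within blocks of a bounded continuous process vanishes as the
blocks shrink. -/
theorem tendsto_integral_blockOsc [IsProbabilityMeasure P] (hts : t ≤ s) {H : ℝ → Ω → ℝ} {c K : ℝ}
    (hH : ∀ u ∈ Set.Icc t s, Measurable (H u))
    (hcont : ∀ᵐ ω ∂P, ContinuousOn (fun u => H u ω) (Set.Icc t s))
    (hcK : ∀ u ω, H u ω ∈ Set.Icc c K) (m : ℕ → ℕ) :
    Tendsto (fun k => ∫ ω, blockOsc H (gridPoint t s ((k + 1) * (m k + 1))) (k + 1) (m k + 1) ω ∂P)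
      atTop (nhds 0) := by
  have hne : ∀ k, (k + 1) * (m k + 1) ≠ 0 := fun k =>
    Nat.mul_ne_zero (Nat.succ_ne_zero _) (Nat.succ_ne_zero _)
  have hmono := fun k => monotone_gridPoint hts ((k + 1) * (m k + 1))
  have hidx : ∀ k, ∀ i < k + 1, ∀ l < m k + 1, i * (m k + 1) + l ≤ (k + 1) * (m k + 1) :=
    fun k i hi l hl => by
      have : (i + 1) * (m k + 1) ≤ (k + 1) * (m k + 1) := Nat.mul_le_mul_right _ hi
      rw [Nat.succ_mul] at this
      omega
  have hlen : ∀ k, gridPoint t s ((k + 1) * (m k + 1)) ((k + 1) * (m k + 1))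
      - gridPoint t s ((k + 1) * (m k + 1)) 0 = s - t := fun k => by
    rw [gridPoint_self (hne k), gridPoint_zero]
  have hst : 0 ≤ s - t := sub_nonneg.2 hts
  rw [show (0 : ℝ) = ∫ _ : Ω, (0 : ℝ) ∂P by simp]
  refine tendsto_integral_of_dominated_convergence (fun _ => (K - c) ^ 2 * (s - t)) (fun k => ?_)
    (integrable_const _) (fun k => ae_of_all _ fun ω => ?_) ?_
  · refine Measurable.aestronglyMeasurable ?_
    unfold blockOsc
    refine Finset.measurable_fun_sum _ fun i hi => Finset.measurable_fun_sum _ fun l hl => ?_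
    have hi' := Finset.mem_range.1 hi
    exact (((hH _ (gridPoint_mem hts (hne k) (hidx k i hi' l (Finset.mem_range.1 hl)))).sub
      (hH _ (gridPoint_mem hts (hne k) (hidx k i hi' 0 (Nat.succ_pos _))))).pow_const 2).mul_const _
  · rw [Real.norm_eq_abs, abs_of_nonneg (blockOsc_nonneg H (hmono k) _ _ ω), ← hlen k]
    refine blockOsc_le (hmono k) fun i _ l _ => ?_
    have h1 := hcK (gridPoint t s ((k + 1) * (m k + 1)) (i * (m k + 1) + l)) ω
    have h2 := hcK (gridPoint t s ((k + 1) * (m k + 1)) (i * (m k + 1))) ω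
    rw [abs_le]
    exact ⟨by linarith [h1.1, h2.2], by linarith [h1.2, h2.1]⟩
  · filter_upwards [hcont] with ω hω
    rw [Metric.tendsto_atTop']
    intro ζ hζ
    set η := Real.sqrt (ζ / (2 * (s - t + 1))) with hη
    have hη0 : 0 < η := Real.sqrt_pos.2 (by positivity)
    obtain ⟨N, hN⟩ := eventually_atTop.1
      ((isPartitionSeq_gridPoint hts).eventually_abs_sub_lt hω hη0)
    refine ⟨N, fun k hk => ?_⟩
    rw [Real.dist_0_eq_abs, abs_of_nonneg (blockOsc_nonneg H (hmono k) _ _ ω)]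
    refine (blockOsc_le (hmono k) (η := η) fun i hi l hl => ?_).trans_lt ?_
    · exact (hN k hk.le i hi _ (gridPoint_block_mem hts k (m k) hl) _
        (gridPoint_block_mem hts k (m k) (Nat.succ_pos _))).le
    · rw [hlen k, hη, Real.sq_sqrt (by positivity), div_mul_eq_mul_div, div_lt_iff₀ (by positivity)]
      nlinarith

/-- The quadratic variation of Brownian motion along partitions with vanishing mesh. -/
theorem IsBrownianMotion.memLp_and_tendsto_quadVar [IsProbabilityMeasure P]
    (hB : IsBrownianMotion P 𝓕 B) (ht : 0 ≤ t) {n : ℕ → ℕ} {τ : ℕ → ℕ → ℝ}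
    (hτ : IsPartitionSeq t s n τ) :
    (∀ k, MemLp (fun ω => ∑ i ∈ Finset.range (n k), incr B (τ k i) (τ k (i + 1)) ω ^ 2 - (s - t))
      2 P) ∧
    Tendsto (fun k => ∫ ω, (∑ i ∈ Finset.range (n k), incr B (τ k i) (τ k (i + 1)) ω ^ 2
      - (s - t)) ^ 2 ∂P) atTop (nhds 0) := by
  have hΔ : ∀ k i, 0 ≤ τ k (i + 1) - τ k i := fun k i => sub_nonneg.2 (hτ.mono k (Nat.le_succ i))
  have heq : ∀ k ω, ∑ i ∈ Finset.range (n k), (1 : ℝ) * (incr B (τ k i) (τ k (i + 1)) ω ^ 2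
      - (τ k (i + 1) - τ k i).toNNReal)
      = ∑ i ∈ Finset.range (n k), incr B (τ k i) (τ k (i + 1)) ω ^ 2 - (s - t) := fun k ω => by
    rw [show s - t = ∑ i ∈ Finset.range (n k), (τ k (i + 1) - τ k i) from
      (hτ.sum_sub (fun u => u) k).symm, ← Finset.sum_sub_distrib]
    refine Finset.sum_congr rfl fun i _ => ?_
    rw [Real.coe_toNNReal _ (hΔ k i), one_mul]
  have h := fun k => hB.memLp_and_integral_sq_sum (hτ.mono k) (by rw [hτ.left]; exact ht) (n k)
    (fun _ _ => 1) (fun i x => x ^ 2 - (τ k (i + 1) - τ k i).toNNReal)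
    (fun _ _ => measurable_const) (fun _ _ => memLp_const 1) (fun _ => by fun_prop)
    (fun _ _ => memLp_sq_sub_gaussianReal _ _) (fun _ _ => integral_sq_sub_gaussianReal _)
  simp only [heq] at h
  refine ⟨fun k => (h k).1, ?_⟩
  have hz := hτ.tendsto_sum_sq.mul_const (∫ x : ℝ, (x ^ 2 - 1) ^ 2 ∂(gaussianReal 0 1))
  rw [zero_mul] at hz
  refine hz.congr fun k => ?_
  rw [(h k).2, Finset.sum_mul]
  refine Finset.sum_congr rfl fun i _ => ?_
  rw [integral_sq_sq_sub_gaussianReal, Real.coe_toNNReal _ (hΔ k i)]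
  simp

/-- Itô's formula for `log R` on the event that `R` stays in the compact interval `[c, K]`. -/
theorem IsBrownianMotion.ae_log_eq_of_mem_Icc [IsProbabilityMeasure P]
    (hB : IsBrownianMotion P 𝓕 B) (ht : 0 ≤ t) (hts : t ≤ s) {σ r C : ℝ} {R m I : ℝ → Ω → ℝ}
    (hR : ∀ u ∈ Set.Icc t s, Measurable[𝓕 u.toNNReal] (R u))
    (hcont : ∀ᵐ ω ∂P, ContinuousOn (fun u => R u ω) (Set.Icc t s))
    (hinit : ∀ᵐ ω ∂P, R t ω = r)
    (hm : ∀ ω, Measurable fun u => m u ω) (hC : ∀ u ω, |m u ω| ≤ C)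
    (hI : ∀ u ∈ Set.Icc t s, IsItoIntegral P B R t u (I u))
    (hsde : ∀ u ∈ Set.Icc t s, ∀ᵐ ω ∂P, R u ω = r + (∫ x in t..u, R x ω * m x ω) + σ * I u ω)
    {c K : ℝ} (hc : 0 < c) (hcK : c ≤ K) :
    ∀ᵐ ω ∂P, (∀ u ∈ Set.Icc t s, R u ω ∈ Set.Icc c K) →
      Real.log (R s ω) - Real.log r
        = (∫ u in t..s, m u ω) + σ * incr B t s ω - σ ^ 2 * (s - t) / 2 := by
  obtain ⟨M, hM⟩ := exists_refinement hts hI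
  -- Truncation replaces localisation by stopping times: H is adapted, bounded and bounded away from
  -- zero, so the L² estimates apply. On the event in question it coincides with R at every grid
  -- point.
  set H : ℝ → Ω → ℝ := fun u ω => max c (min K (R u ω)) with hH
  have hHm : ∀ u ∈ Set.Icc t s, Measurable[𝓕 u.toNNReal] (H u) := fun u hu =>
    measurable_const.max (measurable_const.min (hR u hu))
  have hHcont : ∀ᵐ ω ∂P, ContinuousOn (fun u => H u ω) (Set.Icc t s) := hcont.mono fun ω hω =>
    (by fun_prop : Continuous fun x : ℝ => max c (min K x)).comp_continuousOn hω
  have hHcK : ∀ u ω, H u ω ∈ Set.Icc c K := fun u ω =>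
    ⟨le_max_left _ _, max_le hcK (min_le_left _ _)⟩
  set g : ℕ → ℕ → ℝ := fun k => gridPoint t s ((k + 1) * (M k + 1)) with hg
  set p : ℕ → ℕ → ℝ := fun k => gridPoint t s (k + 1) with hp
  have hpart : IsPartitionSeq t s (fun k => k + 1) p := isPartitionSeq_gridPoint hts
  have hgp : ∀ k i, g k (i * (M k + 1)) = p k i := fun k i =>
    gridPoint_mul (k + 1) (Nat.succ_ne_zero (M k)) i
  have hgmem : ∀ k, ∀ j ≤ (k + 1) * (M k + 1), g k j ∈ Set.Icc t s := fun k j hj =>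
    gridPoint_mem hts (Nat.mul_ne_zero (Nat.succ_ne_zero _) (Nat.succ_ne_zero _)) hj
  set F : ℕ → Ω → ℝ := fun k ω =>
    (∑ i ∈ Finset.range (k + 1), blockError B H (g k) (M k + 1) i ω
      / H (g k (i * (M k + 1))) ω) ^ 2
    + ∑ i ∈ Finset.range (k + 1), blockError B H (g k) (M k + 1) i ω ^ 2 with hF
  have hFb := fun k => hB.integral_blockError_le (τ := g k) (monotone_gridPoint hts _)
    (ht.trans_eq (gridPoint_zero _).symm) (q := k + 1) (M := M k + 1) (Nat.succ_pos _) hc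
    (fun j hj => hHm _ (hgmem k j hj.le)) hHcK
  obtain ⟨hQ2, hQ⟩ := hB.memLp_and_tendsto_quadVar ht hpart
  set Q : ℕ → Ω → ℝ := fun k ω =>
    ∑ i ∈ Finset.range (k + 1), incr B (p k i) (p k (i + 1)) ω ^ 2 - (s - t) with hQdef
  have hF0 : ∀ k ω, 0 ≤ F k ω := fun k ω =>
    add_nonneg (sq_nonneg _) (Finset.sum_nonneg fun _ _ => sq_nonneg _)
  have hFlim : Tendsto (fun k => ∫ ω, F k ω ∂P) atTop (nhds 0) := by
    have h := (tendsto_integral_blockOsc hts (fun u hu => (hHm u hu).mono (𝓕.le _) le_rfl)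
      hHcont hHcK M).const_mul (1 / c ^ 2 + 1)
    rw [mul_zero] at h
    exact squeeze_zero (fun k => integral_nonneg (hF0 k)) (fun k => (hFb k).2) h
  -- Block errors and quadratic variation are bundled into one nonnegative sequence, so that a
  -- single subsequence serves all three limits.
  obtain ⟨ns, hns, hae⟩ := exists_seq_tendsto_ae_of_tendsto_integral
    (F := fun k ω => F k ω + Q k ω ^ 2) (fun k => (hFb k).1.add (hQ2 k).integrable_sq)
    (fun k ω => add_nonneg (hF0 k ω) (sq_nonneg _)) (by
      have h := hFlim.add hQ
      rw [add_zero] at h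
      refine h.congr fun k => ?_
      rw [integral_add (hFb k).1 (hQ2 k).integrable_sq])
  have hsde' : ∀ᵐ ω ∂P, ∀ k, ∀ i ≤ k + 1,
      R (p k i) ω = r + (∫ x in t..p k i, R x ω * m x ω) + σ * I (p k i) ω := by
    refine ae_all_iff.2 fun k => ae_all_iff.2 fun i => ?_
    by_cases hi : i ≤ k + 1
    · filter_upwards [hsde _ (hpart.mem_Icc (k := k) hi)] with ω hω _ using hω
    · exact ae_of_all _ fun ω h => absurd h hi
  filter_upwards [hM, hae, hcont, hinit, hsde'] with ω hMω hFω hcω hiω hsω hmem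
  have hHR : ∀ u ∈ Set.Icc t s, H u ω = R u ω := fun u hu => by
    simp only [hH, min_eq_right (hmem u hu).2, max_eq_right (hmem u hu).1]
  set e : ℕ → ℕ → ℝ := fun k i => blockError B H (g k) (M k + 1) i ω with he
  set eI : ℕ → ℕ → ℝ := fun k i =>
    I (p k (i + 1)) ω - I (p k i) ω - R (p k i) ω * incr B (p k i) (p k (i + 1)) ω with heI
  have hblock : ∀ k, ∀ i < k + 1, e k i = leftSum B R ((i + 1) * (M k + 1)) (g k) ω
      - leftSum B R (i * (M k + 1)) (g k) ω - R (p k i) ω * incr B (p k i) (p k (i + 1)) ω := by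
    intro k i hi
    have hle : (i + 1) * (M k + 1) ≤ (k + 1) * (M k + 1) := Nat.mul_le_mul_right _ hi
    rw [Nat.succ_mul] at hle
    rw [← hgp k i, ← hgp k (i + 1), ← blockError_eq]
    refine Finset.sum_congr rfl fun l hl => ?_
    have := Finset.mem_range.1 hl
    rw [hHR _ (hgmem k _ (by omega)), hHR _ (hgmem k _ (by omega))]
  -- The true error eI of a coarse step differs from the block error e only by the approximation
  -- errors of the integral at the two endpoints of that step.
  have hdiff : ∀ᶠ k in atTop, ∀ i < k + 1,
      |eI k i - e k i| ≤ 2 / ((k + 1 : ℕ) : ℝ) ^ 2 := by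
    filter_upwards [hMω] with k hk i hi
    have h1 := hk i hi.le
    have h2 := hk (i + 1) hi
    have h3 : eI k i - e k i = (leftSum B R (i * (M k + 1)) (g k) ω - I (p k i) ω)
        - (leftSum B R ((i + 1) * (M k + 1)) (g k) ω - I (p k (i + 1)) ω) := by
      rw [hblock k i hi]
      ring
    rw [h3]
    refine (abs_sub _ _).trans ((add_le_add h1 h2).trans_eq ?_)
    ring
  have hRc : ∀ k, ∀ i < k + 1, c ≤ R (p k i) ω := fun k i hi =>
    (hmem _ (hpart.mem_Icc (k := k) (Nat.le_of_lt hi))).1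
  have hHp : ∀ k, ∀ i < k + 1, H (g k (i * (M k + 1))) ω = R (p k i) ω := fun k i hi => by
    rw [hgp]
    exact hHR _ (hpart.mem_Icc (k := k) (Nat.le_of_lt hi))
  have hF1 : Tendsto (fun k => ∑ i ∈ Finset.range (ns k + 1), e (ns k) i / R (p (ns k) i) ω)
      atTop (nhds 0) := by
    have h := hFω.sqrt
    rw [Real.sqrt_zero] at h
    refine squeeze_zero_norm (fun k => Real.abs_le_sqrt ?_) h
    have h1 : ∑ i ∈ Finset.range (ns k + 1), e (ns k) i / R (p (ns k) i) ω
        = ∑ i ∈ Finset.range (ns k + 1), e (ns k) i / H (g (ns k) (i * (M (ns k) + 1))) ω :=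
      Finset.sum_congr rfl fun i hi => by rw [hHp _ _ (Finset.mem_range.1 hi)]
    rw [h1, add_assoc]
    exact le_add_of_nonneg_right
      (add_nonneg (Finset.sum_nonneg fun _ _ => sq_nonneg _) (sq_nonneg _))
  have hF2 : Tendsto (fun k => ∑ i ∈ Finset.range (ns k + 1), e (ns k) i ^ 2) atTop (nhds 0) := by
    refine squeeze_zero (fun k => Finset.sum_nonneg fun _ _ => sq_nonneg _) (fun k => ?_) hFω
    have h1 := sq_nonneg (∑ i ∈ Finset.range (ns k + 1), e (ns k) i
      / H (g (ns k) (i * (M (ns k) + 1))) ω)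
    have h2 := sq_nonneg (Q (ns k) ω)
    simp only [hF, he] at h1 ⊢
    linarith
  have hF3 : Tendsto (fun k => ∑ i ∈ Finset.range (ns k + 1),
      (B (p (ns k) (i + 1)).toNNReal ω - B (p (ns k) i).toNNReal ω) ^ 2)
      atTop (nhds (s - t)) := by
    have h := hFω.sqrt
    rw [Real.sqrt_zero] at h
    have h1 : Tendsto (fun k => Q (ns k) ω) atTop (nhds 0) :=
      squeeze_zero_norm (fun k => Real.abs_le_sqrt (le_add_of_nonneg_left (hF0 _ ω))) h
    have h2 := h1.add_const (s - t)
    rw [zero_add] at h2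
    refine h2.congr fun k => ?_
    simp only [hQdef, sub_add_cancel]
  have hD2 : Tendsto (fun k => ∑ i ∈ Finset.range (k + 1), (eI k i - e k i) ^ 2)
      atTop (nhds 0) := by
    refine squeeze_zero' (Eventually.of_forall fun k => Finset.sum_nonneg fun _ _ => sq_nonneg _)
      ?_ (tendsto_div_add_one 4)
    filter_upwards [hdiff] with k hk
    have hx : (1 : ℝ) ≤ ((k + 1 : ℕ) : ℝ) := by
      push_cast
      linarith [(Nat.cast_nonneg k : (0 : ℝ) ≤ k)]
    calc ∑ i ∈ Finset.range (k + 1), (eI k i - e k i) ^ 2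
        ≤ ∑ i ∈ Finset.range (k + 1), (2 / ((k + 1 : ℕ) : ℝ) ^ 2) ^ 2 := by
          refine Finset.sum_le_sum fun i hi => ?_
          rw [← sq_abs]
          have := hk i (Finset.mem_range.1 hi)
          gcongr
      _ = 4 / ((k + 1 : ℕ) : ℝ) ^ 3 := by
          rw [Finset.sum_const, Finset.card_range, nsmul_eq_mul]
          field_simp
          norm_num
      _ ≤ 4 / ((k + 1 : ℕ) : ℝ) := by
          gcongr
          exact le_self_pow₀ hx (by norm_num)
  have hD1 : Tendsto (fun k => ∑ i ∈ Finset.range (k + 1), (eI k i - e k i) / R (p k i) ω)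
      atTop (nhds 0) := by
    refine squeeze_zero_norm' ?_ (tendsto_div_add_one (2 / c))
    filter_upwards [hdiff] with k hk
    calc ‖∑ i ∈ Finset.range (k + 1), (eI k i - e k i) / R (p k i) ω‖
        ≤ ∑ i ∈ Finset.range (k + 1), 2 / ((k + 1 : ℕ) : ℝ) ^ 2 / c := by
          refine (norm_sum_le _ _).trans (Finset.sum_le_sum fun i hi => ?_)
          have hi' := Finset.mem_range.1 hi
          rw [norm_div, Real.norm_eq_abs, Real.norm_eq_abs,
            abs_of_pos (hc.trans_le (hRc k i hi'))]
          exact div_le_div₀ (by positivity) (hk i hi') hc (hRc k i hi')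
      _ = 2 / c / ((k + 1 : ℕ) : ℝ) := by
          rw [Finset.sum_const, Finset.card_range, nsmul_eq_mul]
          field_simp
  have hfinal := log_sub_log_eq_of_tendsto (σ := σ) (hpart.comp hns) (R := fun u => R u ω)
    (β := fun u => B u.toNNReal ω) (m := fun u => m u ω) (I := fun u => I u ω) hcω
    (fun u hu => hc.trans_le (hmem u hu).1) (hm ω) (fun u => hC u ω)
    (fun k i hi => by rw [hiω]; exact hsω (ns k) i hi) ?_ ?_ hF3
  · rw [hiω] at hfinal
    exact hfinal
  · have h := hF1.add (hD1.comp hns.tendsto_atTop)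
    rw [add_zero] at h
    refine h.congr fun k => ?_
    simp only [Function.comp_apply]
    rw [← Finset.sum_add_distrib]
    refine Finset.sum_congr rfl fun i _ => ?_
    rw [← add_div, add_sub_cancel]
  · refine (tendsto_sum_sq_add hF2 (hD2.comp hns.tendsto_atTop)).congr fun k => ?_
    refine Finset.sum_congr rfl fun i _ => ?_
    simp only [add_sub_cancel]
    rfl

end Uniqueness

/-! ### Every admissible reputation is the explicit solution. -/

section Control

variable {P : Measure Ω} {𝓕 : Filtration ℝ≥0 mΩ} {B : ℝ≥0 → Ω → ℝ} {ε T t σ r : ℝ}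
  {μ R : ℝ → Ω → ℝ}

/-- The control `μ`, clamped to `[-ε, ε]` and extended from `[t, T]` to all times. -/
noncomputable def clampedControl (ε : ℝ) {t T : ℝ} (htT : t ≤ T) (μ : ℝ → Ω → ℝ) (s : ℝ) (ω : Ω) :
    ℝ :=
  max (-ε) (min ε (μ (Set.projIcc t T htT s) ω))

theorem abs_clampedControl_le (hε : 0 ≤ ε) (htT : t ≤ T) (s : ℝ) (ω : Ω) :
    |clampedControl ε htT μ s ω| ≤ ε :=
  abs_le.2 ⟨le_max_left _ _, max_le (by linarith) (min_le_left _ _)⟩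

theorem IsControl.measurable_clampedControl (h : IsControl P 𝓕 ε T t μ) (htT : t ≤ T) :
    Measurable fun p : ℝ × Ω => clampedControl ε htT μ p.1 p.2 := by
  have h1 : Measurable fun p : ℝ × Ω => (Set.projIcc t T htT p.1, p.2) :=
    (continuous_projIcc.measurable.comp measurable_fst).prodMk measurable_snd
  exact measurable_const.max (measurable_const.min (h.measurable.comp h1))

theorem IsControl.measurable_clampedControl_path (h : IsControl P 𝓕 ε T t μ) (htT : t ≤ T)
    (ω : Ω) : Measurable fun u => clampedControl ε htT μ u ω :=
  (h.measurable_clampedControl htT).comp measurable_prodMk_right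

theorem IsControl.ae_clampedControl_eq (h : IsControl P 𝓕 ε T t μ) (htT : t ≤ T) :
    ∀ᵐ ω ∂P, ∀ s ∈ Set.Icc t T, clampedControl ε htT μ s ω = μ s ω := by
  filter_upwards [h.bound] with ω hω s hs
  have h1 := abs_le.1 (hω s hs)
  rw [clampedControl, Set.projIcc_of_mem htT hs, min_eq_right h1.2, max_eq_right h1.1]

/-- Uniqueness for the state equation, at a fixed time. -/
theorem IsAdmissible.ae_eq_solution_at [IsProbabilityMeasure P] (hB : IsBrownianMotion P 𝓕 B)
    (hA : IsAdmissible P 𝓕 B σ ε T t r μ R) (ht : 0 ≤ t) (htT : t ≤ T) (hr : 0 < r)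
    (hε : 0 ≤ ε) {s : ℝ} (hs : s ∈ Set.Icc t T) :
    ∀ᵐ ω ∂P, R s ω = solution B σ r t (fun u => clampedControl ε htT μ u ω) s ω := by
  obtain ⟨I, hI⟩ := hA.state.sde
  have hsub : Set.Icc t s ⊆ Set.Icc t T := Set.Icc_subset_Icc_right hs.2
  have hctrl := hA.control.ae_clampedControl_eq htT
  -- Almost every path is continuous and positive on the compact interval [t, s], hence stays in
  -- [1/(N + 1), N + 1] for some N. The countably many exceptional null sets can be united.
  have hlog : ∀ N : ℕ, ∀ᵐ ω ∂P,
      (∀ u ∈ Set.Icc t s, R u ω ∈ Set.Icc (1 / ((N : ℝ) + 1)) ((N : ℝ) + 1)) →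
      Real.log (R s ω) - Real.log r
        = (∫ u in t..s, clampedControl ε htT μ u ω) + σ * incr B t s ω
          - σ ^ 2 * (s - t) / 2 := fun N => by
    have hN : (1 : ℝ) ≤ (N : ℝ) + 1 := by linarith [(Nat.cast_nonneg N : (0 : ℝ) ≤ N)]
    refine hB.ae_log_eq_of_mem_Icc ht hs.1 (C := ε) (I := I)
      (fun u hu => hA.state.adapted u (hsub hu))
      (hA.state.continuousOn.mono fun ω hω => hω.mono hsub) hA.state.initial
      (hA.control.measurable_clampedControl_path htT)
      (fun u ω => abs_clampedControl_le hε htT u ω) (fun u hu => (hI u (hsub hu)).1)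
      (fun u hu => ?_) (by positivity) ((div_le_one (by positivity)).2 hN |>.trans hN)
    filter_upwards [(hI u (hsub hu)).2, hctrl] with ω hω hc
    have h1 : ∫ x in t..u, R x ω * clampedControl ε htT μ x ω = ∫ x in t..u, R x ω * μ x ω := by
      refine intervalIntegral.integral_congr fun x hx => ?_
      rw [Set.uIcc_of_le hu.1] at hx
      simp only [hc x ⟨hx.1, hx.2.trans (hsub hu).2⟩]
    rw [hω, h1]
  filter_upwards [ae_all_iff.2 hlog, hA.state.continuousOn, hA.state.pos] with ω hω hcont hpos
  have hcont' := hcont.mono hsub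
  obtain ⟨x₀, hx₀, hmin⟩ := isCompact_Icc.exists_isMinOn ⟨t, Set.left_mem_Icc.2 hs.1⟩ hcont'
  obtain ⟨K, hK⟩ := isCompact_Icc.exists_bound_of_continuousOn hcont'
  have hx₀' := hpos x₀ (hsub hx₀)
  obtain ⟨N₁, hN₁⟩ := exists_nat_ge K
  obtain ⟨N₂, hN₂⟩ := exists_nat_one_div_lt hx₀'
  have h := hω (max N₁ N₂) fun u hu => ?_
  · rw [sub_eq_iff_eq_add] at h
    rw [← Real.exp_log (hpos s hs), h, Real.exp_add, Real.exp_log hr, solution, expMart,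
      mul_assoc r, ← Real.exp_add, mul_comm]
    ring_nf
  · refine ⟨le_trans ?_ (hN₂.le.trans (hmin hu)), ?_⟩
    · refine one_div_le_one_div_of_le (by positivity) ?_
      gcongr
      exact le_max_right _ _
    · have h1 : (N₁ : ℝ) ≤ (max N₁ N₂ : ℕ) := by exact_mod_cast le_max_left _ _
      linarith [(le_abs_self _).trans (hK u hu)]

theorem IsBrownianMotion.ae_continuous_solution (hB : IsBrownianMotion P 𝓕 B) {m : ℝ → Ω → ℝ}
    {C : ℝ} (hm : ∀ ω, Measurable fun u => m u ω) (hC : ∀ u ω, |m u ω| ≤ C) (σ r t : ℝ) :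
    ∀ᵐ ω ∂P, Continuous fun s => solution B σ r t (fun u => m u ω) s ω := by
  filter_upwards [hB.ae_continuous_expMart σ t] with ω hω
  have := (lipschitzWith_integral (hm ω) (fun u => hC u ω) t).continuous
  unfold solution
  fun_prop

/-- Uniqueness for the state equation. -/
theorem IsAdmissible.ae_eq_solution [IsProbabilityMeasure P] (hB : IsBrownianMotion P 𝓕 B)
    (hA : IsAdmissible P 𝓕 B σ ε T t r μ R) (ht : 0 ≤ t) (htT : t ≤ T) (hr : 0 < r)
    (hε : 0 ≤ ε) :
    ∀ᵐ ω ∂P, ∀ s ∈ Set.Icc t T,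
      R s ω = solution B σ r t (fun u => clampedControl ε htT μ u ω) s ω := by
  obtain ⟨D, hDc, hDd⟩ := TopologicalSpace.exists_countable_dense (Set.Icc t T)
  have hD : ∀ᵐ ω ∂P, ∀ s ∈ D,
      R s ω = solution B σ r t (fun u => clampedControl ε htT μ u ω) s ω :=
    (ae_ball_iff hDc).2 fun s _ => hA.ae_eq_solution_at hB ht htT hr hε s.2
  filter_upwards [hD, hA.state.continuousOn, hB.ae_continuous_solution
    (hA.control.measurable_clampedControl_path htT)
    (abs_clampedControl_le hε htT) σ r t] with ω hω hc hc' s hs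
  have h := Continuous.ext_on hDd hc.domRestrict (hc'.comp continuous_subtype_val)
    (fun s hs => hω s hs)
  exact congrFun h ⟨s, hs⟩

end Control

/-! ### The expected gain as an expectation weighted by an exponential martingale. -/

section Gain

variable {P : Measure Ω} {𝓕 : Filtration ℝ≥0 mΩ} {B : ℝ≥0 → Ω → ℝ}

/-- Fubini needs joint measurability, but paths are continuous only almost surely. Setting the
process to zero on a measurable null set makes every path continuous, which gives joint
measurability. -/
theorem IsBrownianMotion.exists_measurable_expMart (hB : IsBrownianMotion P 𝓕 B) (σ t : ℝ) :
    ∃ Z : ℝ → Ω → ℝ, Measurable (Function.uncurry Z) ∧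
      (∀ s ω, 0 ≤ Z s ω) ∧ ∀ᵐ ω ∂P, ∀ s, Z s ω = expMart B σ t s ω := by
  obtain ⟨G, hsub, hGm, hG0⟩ := exists_measurable_superset_of_null
    (ae_iff.1 (hB.ae_continuous_expMart σ t))
  refine ⟨fun s => Gᶜ.indicator (expMart B σ t s),
    measurable_uncurry_of_continuous_of_measurable (fun ω => ?_) (fun s => ?_),
    fun s ω => Set.indicator_nonneg (fun ω _ => (expMart_pos ω).le) ω, ?_⟩
  · by_cases hω : ω ∈ G
    · simpa [hω] using continuous_const
    · have : Continuous fun s => expMart B σ t s ω := by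
        by_contra h
        exact hω (hsub h)
      simpa [hω] using this
  · refine Measurable.indicator ?_ hGm.compl
    exact Real.measurable_exp.comp (((hB.measurable_incr' t s).const_mul σ).sub_const _)
  · have : ∀ᵐ ω ∂P, ω ∉ G := measure_eq_zero_iff_ae_notMem.1 hG0
    filter_upwards [this] with ω hω s
    exact Set.indicator_of_mem (Set.mem_compl hω) _

theorem measurable_integral_uncurry {m : ℝ → Ω → ℝ} {C : ℝ} (hm : Measurable (Function.uncurry m))
    (hC : ∀ s ω, |m s ω| ≤ C) (t : ℝ) :
    Measurable (Function.uncurry fun s ω => ∫ u in t..s, m u ω) := by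
  refine measurable_uncurry_of_continuous_of_measurable (fun ω => ?_) fun s => ?_
  · exact (lipschitzWith_integral (hm.comp measurable_prodMk_right) (fun u => hC u ω) t).continuous
  · have h : ∀ x y : ℝ, Measurable fun ω => ∫ u in Set.Ioc x y, m u ω := fun x y =>
      (StronglyMeasurable.integral_prod_left (f := m)
        (μ := volume.restrict (Set.Ioc x y)) hm.stronglyMeasurable).measurable
    exact (h t s).sub (h s t)

/-- A bounded process that is, at each time, a modification of an adapted variable may be moved
inside the exponential martingale evaluated at the terminal time. -/
theorem IsBrownianMotion.integral_mul_expMart_eq [IsProbabilityMeasure P]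
    (hB : IsBrownianMotion P 𝓕 B) {σ t s T K : ℝ} (ht : 0 ≤ t) (hts : t ≤ s) (hsT : s ≤ T)
    {X : Ω → ℝ} (hX : Measurable[𝓕 s.toNNReal] X) (hK : ∀ᵐ ω ∂P, |X ω| ≤ K) :
    ∫ ω, X ω * expMart B σ t T ω ∂P = ∫ ω, X ω * expMart B σ t s ω ∂P := by
  have hZ : Integrable (expMart B σ t s) P := (hB.memLp_expMart ht hts).integrable (by norm_num)
  have hZ' : Integrable (expMart B σ s T) P :=
    (hB.memLp_expMart (ht.trans hts) hsT).integrable (by norm_num)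
  have hXZ : Integrable (fun ω => X ω * expMart B σ t s ω) P :=
    hZ.bdd_mul (hX.mono (𝓕.le _) le_rfl).aestronglyMeasurable hK
  have hind : IndepFun (fun ω => X ω * expMart B σ t s ω) (expMart B σ s T) P := by
    have h1 := hB.indep_comp_incr hsT
      (φ := fun x => Real.exp (σ * x - σ ^ 2 * (T - s) / 2)) (by fun_prop)
    exact (indep_of_indep_of_le_right h1
      (hX.mul (hB.measurable_expMart hts)).comap_le).symm
  have h := hind.integral_fun_mul_eq_mul_integral hXZ.aestronglyMeasurable
    hZ'.aestronglyMeasurable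
  rw [hB.integral_expMart (ht.trans hts) hsT, mul_one] at h
  rw [← h]
  refine integral_congr_ae (ae_of_all _ fun ω => ?_)
  simp only
  rw [expMart_mul (s := s) T]
  ring

variable {γ ρ σ ε T t r : ℝ} {μ R : ℝ → Ω → ℝ}

/-- The running reward after division by the exponential martingale with exponent `γ σ`. -/
noncomputable def reward (γ ρ σ t : ℝ) (m : ℝ → ℝ) (s : ℝ) : ℝ :=
  Real.exp ((σ ^ 2 / 2 * γ * (γ - 1) - ρ) * s) * (1 - m s) * Real.exp (∫ u in t..s, γ * m u)

theorem abs_reward_le (γ ρ σ : ℝ) {m : ℝ → ℝ} (hC : ∀ s, |m s| ≤ ε) {s : ℝ}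
    (hs : s ∈ Set.Icc t T) :
    |reward γ ρ σ t m s| ≤ Real.exp (|σ ^ 2 / 2 * γ * (γ - 1) - ρ| * max |t| |T|) * (1 + ε)
      * Real.exp (|γ| * ε * (T - t)) := by
  have hε : 0 ≤ ε := (abs_nonneg _).trans (hC 0)
  rw [reward, abs_mul, abs_mul, Real.abs_exp, Real.abs_exp]
  have h1 : (σ ^ 2 / 2 * γ * (γ - 1) - ρ) * s
      ≤ |σ ^ 2 / 2 * γ * (γ - 1) - ρ| * max |t| |T| := by
    refine (le_abs_self _).trans ?_
    rw [abs_mul]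
    gcongr
    exact abs_le_max_abs_abs hs.1 hs.2
  have h2 : |1 - m s| ≤ 1 + ε := by
    have := abs_le.1 (hC s)
    rw [abs_le]
    constructor <;> linarith
  have h3 : ∫ u in t..s, γ * m u ≤ |γ| * ε * (T - t) := by
    have h := intervalIntegral.norm_integral_le_of_norm_le_const (a := t) (b := s)
      (f := fun u => γ * m u) (C := |γ| * ε) fun u _ => by
        rw [norm_mul]
        exact mul_le_mul_of_nonneg_left (hC u) (abs_nonneg _)
    refine (le_abs_self _).trans (h.trans ?_)
    rw [abs_of_nonneg (sub_nonneg.2 hs.1)]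
    have := hs.2
    gcongr
  gcongr

/-- Along the solution of the state equation the gain is the integral of the reward against the
exponential martingale with exponent `γ σ`. -/
theorem solution_rpow (hr : 0 < r) (m : ℝ → ℝ) (s : ℝ) (ω : Ω) :
    Real.exp (-ρ * s) * (1 - m s) * solution B σ r t m s ω ^ γ
      = r ^ γ * Real.exp (-(σ ^ 2 / 2 * γ * (γ - 1)) * t)
        * (reward γ ρ σ t m s * expMart B (γ * σ) t s ω) := by
  rw [solution, expMart, Real.mul_rpow (by positivity) (Real.exp_pos _).le,
    Real.mul_rpow hr.le (Real.exp_pos _).le, ← Real.exp_mul, ← Real.exp_mul, reward, expMart,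
    intervalIntegral.integral_const_mul]
  have h : Real.exp (-ρ * s) * Real.exp ((∫ u in t..s, m u) * γ)
      * Real.exp ((σ * incr B t s ω - σ ^ 2 * (s - t) / 2) * γ)
      = Real.exp (-(σ ^ 2 / 2 * γ * (γ - 1)) * t)
        * Real.exp ((σ ^ 2 / 2 * γ * (γ - 1) - ρ) * s) * Real.exp (γ * ∫ u in t..s, m u)
        * Real.exp (γ * σ * incr B t s ω - (γ * σ) ^ 2 * (s - t) / 2) := by
    rw [← Real.exp_add, ← Real.exp_add, ← Real.exp_add, ← Real.exp_add, ← Real.exp_add]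
    congr 1
    ring
  linear_combination (1 - m s) * r ^ γ * h

/-- The expected gain is the expectation of the pathwise reward under the measure with density the
exponential martingale with exponent `γ σ`. -/
theorem IsAdmissible.integral_gain [IsProbabilityMeasure P] (hB : IsBrownianMotion P 𝓕 B)
    (hA : IsAdmissible P 𝓕 B σ ε T t r μ R) (ht : 0 ≤ t) (htT : t ≤ T) (hr : 0 < r)
    (hε : 0 ≤ ε) :
    Integrable (gain γ ρ T t μ R) P ∧
    Integrable (fun ω => (∫ s in t..T, reward γ ρ σ t (fun u => clampedControl ε htT μ u ω) s)
        * expMart B (γ * σ) t T ω) P ∧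
    ∫ ω, gain γ ρ T t μ R ω ∂P
      = r ^ γ * Real.exp (-(σ ^ 2 / 2 * γ * (γ - 1)) * t)
        * ∫ ω, (∫ s in t..T, reward γ ρ σ t (fun u => clampedControl ε htT μ u ω) s)
          * expMart B (γ * σ) t T ω ∂P := by
  set m : ℝ → Ω → ℝ := fun u ω => clampedControl ε htT μ u ω with hm
  have hmm : Measurable (Function.uncurry m) := hA.control.measurable_clampedControl htT
  have hmC : ∀ s ω, |m s ω| ≤ ε := abs_clampedControl_le hε htT
  set Y : ℝ → Ω → ℝ := fun s ω => reward γ ρ σ t (fun u => m u ω) s with hY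
  have hYm : Measurable (Function.uncurry Y) := by
    have h1 := measurable_integral_uncurry (m := fun u ω => γ * m u ω) (C := |γ| * ε)
      (hmm.const_mul γ) (fun s ω => by
        rw [abs_mul]; exact mul_le_mul_of_nonneg_left (hmC s ω) (abs_nonneg _)) t
    have h2 : Measurable fun p : ℝ × Ω => Real.exp ((σ ^ 2 / 2 * γ * (γ - 1) - ρ) * p.1) := by
      fun_prop
    exact (h2.mul (measurable_const.sub hmm)).mul (Real.measurable_exp.comp h1)
  obtain ⟨K, hK⟩ : ∃ K, ∀ s ∈ Set.Icc t T, ∀ ω, |Y s ω| ≤ K :=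
    ⟨_, fun s hs ω => abs_reward_le γ ρ σ (fun u => hmC u ω) hs⟩
  obtain ⟨Z, hZm, hZ0, hZ⟩ := hB.exists_measurable_expMart (γ * σ) t
  set ν : Measure ℝ := volume.restrict (Set.Ioc t T) with hν
  have hνmem : ∀ᵐ s ∂ν, s ∈ Set.Icc t T :=
    (ae_restrict_mem measurableSet_Ioc).mono fun s hs => Set.Ioc_subset_Icc_self hs
  have hZs : ∀ s, Z s =ᵐ[P] expMart B (γ * σ) t s := fun s => hZ.mono fun ω hω => hω s
  have hM : ∀ s ∈ Set.Icc t T, Integrable (expMart B (γ * σ) t s) P := fun s hs =>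
    (hB.memLp_expMart ht hs.1).integrable (by norm_num)
  have hTmem : T ∈ Set.Icc t T := ⟨htT, le_rfl⟩
  have hprodmem : ∀ᵐ p ∂(ν.prod P), p.1 ∈ Set.Icc t T :=
    Measure.quasiMeasurePreserving_fst.ae hνmem
  have hKprod : ∀ᵐ p ∂(ν.prod P), ‖Function.uncurry Y p‖ ≤ K :=
    hprodmem.mono fun p hp => hK p.1 hp p.2
  have hZint : Integrable (Function.uncurry Z) (ν.prod P) := by
    rw [integrable_prod_iff hZm.aestronglyMeasurable]
    refine ⟨hνmem.mono fun s hs => (hM s hs).congr (hZs s).symm, ?_⟩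
    refine (integrable_const (1 : ℝ)).congr (hνmem.mono fun s hs => ?_)
    rw [← hB.integral_expMart (σ := γ * σ) ht hs.1]
    refine integral_congr_ae ((hZs s).mono fun ω hω => ?_)
    simp only [Function.uncurry]
    rw [Real.norm_eq_abs, abs_of_nonneg (hZ0 s ω), hω]
  have hYZ : Integrable (fun p : ℝ × Ω => Y p.1 p.2 * Z p.1 p.2) (ν.prod P) :=
    hZint.bdd_mul hYm.aestronglyMeasurable hKprod
  have hYZT : Integrable (fun p : ℝ × Ω => Y p.1 p.2 * expMart B (γ * σ) t T p.2) (ν.prod P) :=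
    ((hM T hTmem).comp_snd ν).bdd_mul hYm.aestronglyMeasurable hKprod
  have hgain : gain γ ρ T t μ R =ᵐ[P] fun ω => r ^ γ
      * Real.exp (-(σ ^ 2 / 2 * γ * (γ - 1)) * t) * ∫ s, Y s ω * Z s ω ∂ν := by
    filter_upwards [hA.ae_eq_solution hB ht htT hr hε, hA.control.ae_clampedControl_eq htT, hZ]
      with ω hsol hctrl hZω
    rw [gain, hν, ← intervalIntegral.integral_of_le htT, ← intervalIntegral.integral_const_mul]
    refine intervalIntegral.integral_congr fun s hs => ?_
    rw [Set.uIcc_of_le htT] at hs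
    rw [hsol s hs, ← hctrl s hs, hZω s]
    exact solution_rpow hr (fun u => m u ω) s ω
  have hinner : ∀ᵐ s ∂ν, ∫ ω, Y s ω * Z s ω ∂P = ∫ ω, Y s ω * expMart B (γ * σ) t T ω ∂P := by
    filter_upwards [hνmem] with s hs
    -- The control is measurable and adapted but not assumed progressively measurable, so ∫_t^s μ
    -- need not be 𝓕_s-measurable. Its exponential is recovered almost surely as R_s/(r M_s), which
    -- is, because R is adapted.
    set X : Ω → ℝ := fun ω => Real.exp ((σ ^ 2 / 2 * γ * (γ - 1) - ρ) * s) * (1 - μ s ω)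
      * (R s ω / (r * expMart B σ t s ω)) ^ γ with hX
    have hXm : Measurable[𝓕 s.toNNReal] X :=
      (measurable_const.mul (measurable_const.sub (hA.control.adapted s hs))).mul
        (((hA.state.adapted s hs).div ((hB.measurable_expMart hs.1).const_mul r)).pow_const γ)
    have hXY : X =ᵐ[P] Y s := by
      filter_upwards [hA.ae_eq_solution hB ht htT hr hε, hA.control.ae_clampedControl_eq htT]
        with ω hsol hctrl
      have h1 : R s ω / (r * expMart B σ t s ω) = Real.exp (∫ u in t..s, m u ω) := by
        rw [hsol s hs, solution]
        have := (expMart_pos (B := B) (σ := σ) (t := t) (s := s) ω).ne'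
        rw [mul_right_comm, mul_div_cancel_left₀ _ (by positivity)]
      simp only [hX, hY]
      rw [h1, ← Real.exp_mul, reward, intervalIntegral.integral_const_mul, mul_comm γ]
      simp only [hm, hctrl s hs]
    have hXK : ∀ᵐ ω ∂P, |X ω| ≤ K := hXY.mono fun ω hω => by rw [hω]; exact hK s hs ω
    have h := hB.integral_mul_expMart_eq (σ := γ * σ) ht hs.1 hs.2 hXm hXK
    calc ∫ ω, Y s ω * Z s ω ∂P = ∫ ω, X ω * expMart B (γ * σ) t s ω ∂P :=
          integral_congr_ae (hXY.symm.mul (hZs s))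
      _ = ∫ ω, X ω * expMart B (γ * σ) t T ω ∂P := h.symm
      _ = ∫ ω, Y s ω * expMart B (γ * σ) t T ω ∂P := integral_congr_ae (hXY.mul (ae_eq_refl _))
  have hswap1 := integral_integral_swap (f := fun s ω => Y s ω * Z s ω) hYZ
  have hswap2 := integral_integral_swap (f := fun s ω => Y s ω * expMart B (γ * σ) t T ω) hYZT
  have hfin : ∀ ω, ∫ s, Y s ω * expMart B (γ * σ) t T ω ∂ν
      = (∫ s in t..T, reward γ ρ σ t (fun u => m u ω) s) * expMart B (γ * σ) t T ω := fun ω => by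
    rw [integral_mul_const, hν, ← intervalIntegral.integral_of_le htT]
  refine ⟨?_, ?_, ?_⟩
  · exact (hYZ.integral_prod_right.const_mul _).congr hgain.symm
  · exact hYZT.integral_prod_right.congr (ae_of_all _ hfin)
  · rw [integral_congr_ae hgain, integral_const_mul, ← hswap1, integral_congr_ae hinner, hswap2]
    exact congrArg _ (integral_congr_ae (ae_of_all _ hfin))

end Gain

/-! ### The upper bound and its attainment. -/

section Optimality

variable {P : Measure Ω} [IsProbabilityMeasure P] {𝓕 : Filtration ℝ≥0 mΩ} {B : ℝ≥0 → Ω → ℝ}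
  {γ ρ σ ε T t r : ℝ} {μ R : ℝ → Ω → ℝ} {ψ : ℝ → ℝ}

theorem exp_discount_mul (γ ρ σ t r x : ℝ) :
    r ^ γ * Real.exp (-(σ ^ 2 / 2 * γ * (γ - 1)) * t)
        * (Real.exp ((σ ^ 2 / 2 * γ * (γ - 1) - ρ) * t) * x) = Real.exp (-ρ * t) * x * r ^ γ := by
  have h : Real.exp (-(σ ^ 2 / 2 * γ * (γ - 1)) * t)
      * Real.exp ((σ ^ 2 / 2 * γ * (γ - 1) - ρ) * t) = Real.exp (-ρ * t) := by
    rw [← Real.exp_add]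
    congr 1
    ring
  rw [← h]
  ring

/-- Verification: no admissible pair gains more than `e^{-ρ t} ψ(t) r^γ`. -/
theorem IsAdmissible.integral_gain_le (hB : IsBrownianMotion P 𝓕 B)
    (hψ : SolvesODE γ ρ σ ε T ψ) (hε : 0 ≤ ε) (ht : t ∈ Set.Icc 0 T) (hr : 0 < r)
    (hA : IsAdmissible P 𝓕 B σ ε T t r μ R) :
    ∫ ω, gain γ ρ T t μ R ω ∂P ≤ Real.exp (-ρ * t) * ψ t * r ^ γ := by
  obtain ⟨-, hint, heq⟩ := hA.integral_gain (γ := γ) (ρ := ρ) hB ht.1 ht.2 hr hε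
  have hM : Integrable (expMart B (γ * σ) t T) P :=
    (hB.memLp_expMart ht.1 ht.2).integrable (by norm_num)
  rw [heq, ← exp_discount_mul γ ρ σ t r (ψ t)]
  -- The pathwise bound is integrated against the positive weight N_T, whose mean is 1.
  have h := integral_mono hint
    (hM.const_mul (Real.exp ((σ ^ 2 / 2 * γ * (γ - 1) - ρ) * t) * ψ t)) fun ω =>
    mul_le_mul_of_nonneg_right (hψ.integral_le ht
      (hA.control.measurable_clampedControl_path ht.2 ω)
      (fun s => abs_clampedControl_le hε ht.2 s ω)) (expMart_pos ω).le
  rw [integral_const_mul, hB.integral_expMart ht.1 ht.2, mul_one] at h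
  gcongr

/-- Verification: the bang-bang control gains `e^{-ρ t} ψ(t) r^γ`. -/
theorem IsAdmissible.integral_gain_bangBang (hB : IsBrownianMotion P 𝓕 B)
    (hψ : SolvesODE γ ρ σ ε T ψ) (hε : 0 < ε) (ht : t ∈ Set.Icc 0 T) (hr : 0 < r)
    (hA : IsAdmissible P 𝓕 B σ ε T t r (fun s _ => bangBang γ ε ψ s) R) :
    ∫ ω, gain γ ρ T t (fun s _ => bangBang γ ε ψ s) R ω ∂P
      = Real.exp (-ρ * t) * ψ t * r ^ γ := by
  obtain ⟨-, -, heq⟩ := hA.integral_gain (γ := γ) (ρ := ρ) hB ht.1 ht.2 hr hε.le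
  have hclamp : ∀ ω, ∀ s ∈ Set.Icc t T,
      clampedControl ε ht.2 (fun s (_ : Ω) => bangBang γ ε ψ s) s ω = bangBang γ ε ψ s := by
    intro ω s hs
    have h1 := abs_le.1 (abs_bangBang_le (γ := γ) (ψ := ψ) hε s)
    rw [clampedControl, Set.projIcc_of_mem ht.2 hs, min_eq_right h1.2, max_eq_right h1.1]
  have hpath : ∀ ω, ∫ s in t..T, reward γ ρ σ t
      (fun u => clampedControl ε ht.2 (fun s (_ : Ω) => bangBang γ ε ψ s) u ω) s
      = Real.exp ((σ ^ 2 / 2 * γ * (γ - 1) - ρ) * t) * ψ t := fun ω =>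
    hψ.integral_eq_of_bangBang ht (hA.control.measurable_clampedControl_path ht.2 ω)
      (fun s => abs_clampedControl_le hε.le ht.2 s ω) (hclamp ω)
  rw [heq, ← exp_discount_mul γ ρ σ t r (ψ t)]
  simp only [hpath]
  rw [integral_const_mul, hB.integral_expMart ht.1 ht.2, mul_one]

/-- The bang-bang control is admissible, and it is adapted to every filtration. -/
theorem exists_isHistoryAdmissible_bangBang (hB : IsBrownianMotion P 𝓕 B)
    (hψ : SolvesODE γ ρ σ ε T ψ) (hε : 0 < ε) (ht : t ∈ Set.Icc 0 T) (hr : 0 < r) :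
    ∃ R, IsHistoryAdmissible P 𝓕 B σ ε T t r (fun s _ => bangBang γ ε ψ s) R := by
  have hsign : Measurable Real.sign :=
    Measurable.ite measurableSet_Iio measurable_const
      (Measurable.ite measurableSet_Ioi measurable_const measurable_const)
  have hbb : Measurable fun s : Set.Icc t T => bangBang γ ε ψ s := by
    have h1 : Continuous fun s : Set.Icc t T => ψ s :=
      (hψ.continuousOn.mono (Set.Icc_subset_Icc_left ht.1)).domRestrict
    exact (hsign.comp ((h1.measurable.const_mul γ).sub_const 1)).const_mul ε
  have hctrl : IsControl P 𝓕 ε T t (fun s (_ : Ω) => bangBang γ ε ψ s) :=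
    ⟨hbb.comp measurable_fst, fun s _ => measurable_const,
      ae_of_all _ fun _ s _ => abs_bangBang_le hε s⟩
  -- ψ is arbitrary outside [0, T], so measurability of the control is available only on [t, T]. It
  -- is extended by constants before the existence result is applied.
  set m : ℝ → ℝ := fun s => bangBang γ ε ψ (Set.projIcc t T ht.2 s) with hm
  have hmm : Measurable m := hbb.comp continuous_projIcc.measurable
  have hsol := hB.isReputation_solution (σ := σ) (T := T) ht.1 hr hmm
    (fun s => abs_bangBang_le hε _)
  have hmeq : ∀ s ∈ Set.Icc t T, m s = bangBang γ ε ψ s := fun s hs => by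
    simp only [hm, Set.projIcc_of_mem ht.2 hs]
  refine ⟨solution B σ r t m, ⟨hctrl, ⟨hsol.adapted, hsol.continuousOn, hsol.pos, hsol.initial,
    ?_⟩⟩, fun s _ => measurable_const⟩
  obtain ⟨I, hI⟩ := hsol.sde
  refine ⟨I, fun s hs => ⟨(hI s hs).1, ?_⟩⟩
  filter_upwards [(hI s hs).2] with ω hω
  rw [hω]
  congr 2
  refine intervalIntegral.integral_congr fun u hu => ?_
  rw [Set.uIcc_of_le hs.1] at hu
  simp only [hmeq u ⟨hu.1, hu.2.trans hs.2⟩]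

end Optimality

end Reputation

theorem mainTheorem1 {Ω : Type*} {mΩ : MeasurableSpace Ω} (P : Measure Ω) [IsProbabilityMeasure P]
    (𝓕 : Filtration ℝ≥0 mΩ) (B : ℝ≥0 → Ω → ℝ) (hB : Reputation.IsBrownianMotion P 𝓕 B)
    (γ ρ σ ε T : ℝ) (hε : 0 < ε) (hT : 0 ≤ T) :
    (∃ ψ : ℝ → ℝ, Reputation.SolvesODE γ ρ σ ε T ψ) ∧
    ∀ ψ : ℝ → ℝ, Reputation.SolvesODE γ ρ σ ε T ψ →
      -- the value function, for controls adapted to `𝓕` and for controls adapted to `R`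
      (∀ t ∈ Set.Icc 0 T, ∀ r : ℝ, 0 < r →
        (∀ μ R, Reputation.IsAdmissible P 𝓕 B σ ε T t r μ R →
          Integrable (Reputation.gain γ ρ T t μ R) P) ∧
        IsLUB (Reputation.expectedGains P γ ρ T t (Reputation.IsAdmissible P 𝓕 B σ ε T t r))
          (Reputation.value P γ ρ T t (Reputation.IsAdmissible P 𝓕 B σ ε T t r)) ∧
        Reputation.value P γ ρ T t (Reputation.IsAdmissible P 𝓕 B σ ε T t r)
          = Real.exp (-ρ * t) * ψ t * r ^ γ ∧
        IsLUB (Reputation.expectedGains P γ ρ T t (Reputation.IsHistoryAdmissible P 𝓕 B σ ε T t r))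
          (Reputation.value P γ ρ T t (Reputation.IsHistoryAdmissible P 𝓕 B σ ε T t r)) ∧
        Reputation.value P γ ρ T t (Reputation.IsHistoryAdmissible P 𝓕 B σ ε T t r)
          = Real.exp (-ρ * t) * ψ t * r ^ γ ∧
        -- the bang-bang control is admissible and optimal
        (∃ R, Reputation.IsHistoryAdmissible P 𝓕 B σ ε T t r
          (fun s _ => Reputation.bangBang γ ε ψ s) R) ∧
        (∀ R, Reputation.IsAdmissible P 𝓕 B σ ε T t r
            (fun s _ => Reputation.bangBang γ ε ψ s) R →
          ∫ ω, Reputation.gain γ ρ T t (fun s _ => Reputation.bangBang γ ε ψ s) R ω ∂P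
            = Reputation.value P γ ρ T t (Reputation.IsAdmissible P 𝓕 B σ ε T t r))) ∧
      -- the explicit solution and the switching time
      (γ = 1 → ρ = 0 → ∀ t ∈ Set.Icc 0 T,
        (T - Real.log (1 + ε) / ε ≤ t →
          ψ t = (1 + ε) / ε * (1 - Real.exp (-ε * (T - t)))) ∧
        (t ≤ T - Real.log (1 + ε) / ε →
          ψ t = (Real.exp (ε * (T - t)) - (1 - ε ^ 2)) / (ε * (1 + ε))) ∧
        (t < T - Real.log (1 + ε) / ε → Reputation.bangBang γ ε ψ t = ε) ∧
        (T - Real.log (1 + ε) / ε < t → Reputation.bangBang γ ε ψ t = -ε)) := by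
  refine ⟨Reputation.exists_solvesODE γ ρ σ ε hT, fun ψ hψ => ⟨fun t ht r hr => ?_, ?_⟩⟩
  · obtain ⟨R₀, hR₀⟩ := Reputation.exists_isHistoryAdmissible_bangBang hB hψ hε ht hr
    -- The supremum is attained. A greatest element determines `sSup` and certifies it as a true
    -- least upper bound, not the default value of `sSup` on ℝ.
    have hgreatest : IsGreatest
        (Reputation.expectedGains P γ ρ T t (Reputation.IsAdmissible P 𝓕 B σ ε T t r))
        (Real.exp (-ρ * t) * ψ t * r ^ γ) :=
      ⟨⟨_, R₀, hR₀.admissible, (hR₀.admissible.integral_gain_bangBang hB hψ hε ht hr).symm⟩,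
        fun J ⟨μ, R, hA, hJ⟩ => hJ ▸ hA.integral_gain_le hB hψ hε.le ht hr⟩
    have hgreatest' : IsGreatest
        (Reputation.expectedGains P γ ρ T t (Reputation.IsHistoryAdmissible P 𝓕 B σ ε T t r))
        (Real.exp (-ρ * t) * ψ t * r ^ γ) :=
      ⟨⟨_, R₀, hR₀, (hR₀.admissible.integral_gain_bangBang hB hψ hε ht hr).symm⟩,
        fun J ⟨μ, R, hA, hJ⟩ => hJ ▸ hA.admissible.integral_gain_le hB hψ hε.le ht hr⟩
    have hvalue : Reputation.value P γ ρ T t (Reputation.IsAdmissible P 𝓕 B σ ε T t r)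
        = Real.exp (-ρ * t) * ψ t * r ^ γ := hgreatest.csSup_eq
    have hvalue' : Reputation.value P γ ρ T t (Reputation.IsHistoryAdmissible P 𝓕 B σ ε T t r)
        = Real.exp (-ρ * t) * ψ t * r ^ γ := hgreatest'.csSup_eq
    refine ⟨fun μ R hA => (hA.integral_gain hB ht.1 ht.2 hr hε.le).1, ?_, hvalue, ?_, hvalue',
      ⟨R₀, hR₀⟩, fun R hA => ?_⟩
    · rw [hvalue]
      exact hgreatest.isLUB
    · rw [hvalue']
      exact hgreatest'.isLUB
    · rw [hvalue]
      exact hA.integral_gain_bangBang hB hψ hε ht hr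
  · rintro rfl rfl t ht
    exact ⟨fun h => hψ.eq_lateSolution hε ht h, fun h => hψ.eq_earlySolution hε ht h,
      fun h => hψ.bangBang_early hε ht h, fun h => hψ.bangBang_late hε ht h⟩
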